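/- **Setting.** Let $A$ be a commutative $\mathbb{Q}$-algebra ("functions of $x$") with a derivation $\partial_x$ and an element $x\in A$ with $\partial_x x=1$ (for example smooth functions on an interval, or $\mathbb{C}[[x]]$). Let $t=(t_1,t_2,\dots)$ be formal times, let $A((\lambda^{-1}))$ be the ring of formal Laurent series with finitely many positive powers of $\lambda$, and let $\mathcal{L}=A((\lambda^{-1}))[[t_1,t_2,\dots]]$. Infinite sums in $\mathcal{L}$ are taken coefficientwise (each monomial $t^\alpha\lambda^k$ occurs in finitely many terms). On $\mathcal{L}$ let $\{F,G\}=\lambda F_\lambda G_x-\lambda F_xG_\lambda$ and $\mathrm{ad}\,\varphi=\{\varphi,\cdot\}$; $(\cdot)_{\ge 0}$ and $(\cdot)_{\le -1}$ are the projections onto nonnegative and negative powers of $\lambda$. Fix signs $\varepsilon_n\in\{1,-1\}$, $n\ge 1$ (for instance $\varepsilon_n=1$ for all $n$, or $\varepsilon_n=(-1)^{n-1}$). A *solution of the hierarchy* is a pair $\Phi,\Psi\in\mathcal{L}$ of the form $$\Phi=\lambda+\sum_{k\ge 0}a_k\lambda^{-k},\qquad \Psi=x+\sum_{n\ge 1}\frac{\varepsilon_n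 t_n}{n}\Phi^n+\sum_{i\ge 1}v_i\Phi^{-i},\qquad a_k,v_i\in A[[t]],$$ with $\{\Phi,\Psi\}=\Phi$ and, for all $n\ge 1$, $\partial_{t_n}\Phi=\{H_n,\Phi\}$ and $\partial_{t_n}\Psi=\{H_n,\Psi\}$, where $H_n=\frac{\varepsilon_n}{n^2}(\Phi^n)_{\ge 0}$. A *dressing function* of $(\Phi,\Psi)$ is a series $\varphi=\sum_{n\ge 1}\varphi_n(t)\lambda^{-n}$, $\varphi_n\in A[[t]]$, with $$\Phi=e^{\mathrm{ad}\,\varphi}\lambda,\qquad \Psi=e^{\mathrm{ad}\,\varphi}\Bigl(x+\sum_{n\ge 1}\frac{\varepsilon_nt_n}{n}\lambda^n\Bigr),\qquad \sum_{j\ge 0}\frac{(\mathrm{ad}\,\varphi)^j\,\partial_{t_n}\varphi}{(j+1)!}=-\frac{\varepsilon_n}{n^2}\bigl(e^{\mathrm{ad}\,\varphi}\lambda^n\bigr)_{\le -1}\quad(n\ge 1).$$ For $f=\sum_k f_k(x)\lambda^k\in A((\lambda^{-1}))$ put $f(\Phi,\Psi)=\sum_{k\in\mathbb{Z}}\sum_{j\ge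 0}\frac{1}{j!}(\partial_x^jf_k)(\Psi-x)^j\Phi^k$. A *twistor structure* of $(\Phi,\Psi)$ is a pair $f,g\in A((\lambda^{-1}))$ with $\{f,g\}=f$ such that $f(\Phi,\Psi)$ and $g(\Phi,\Psi)$ are well defined and $$(f(\Phi,\Psi))_{\le -1}=0,\qquad (g(\Phi,\Psi))_{\le -1}=0 .$$ **Theorem.** Let $(\Phi,\Psi)$ be a solution of the hierarchy. Then $(\Phi,\Psi)$ has a dressing function. Moreover, for every dressing function $\varphi$ of $(\Phi,\Psi)$, the series $$f=e^{-\mathrm{ad}\,\varphi}\big|_{t=0}\,\lambda,\qquad g=e^{-\mathrm{ad}\,\varphi}\big|_{t=0}\,x$$ exist in $A((\lambda^{-1}))$ and $(f,g)$ is a twistor structure of $(\Phi,\Psi)$; that is, $\{f,g\}=f$ and $f(\Phi,\Psi)$, $g(\Phi,\Psi)$ contain no negative powers of $\lambda$. -/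

import Mathlib

noncomputable section

namespace TwistorHierarchy

/-! `A` is a commutative `ℚ`-algebra of functions of `x`, with derivation `D = ∂/∂x`; the element
`x : A` with `D x = 1` is the coordinate. The time variables are `t n`, with `n` in `ℕ+`. -/

/-- Formal power series in the times `t 1, t 2, …` whose coefficients are formal Laurent series
with finitely many positive powers of `λ` and coefficients in `A`, i.e. `A((λ⁻¹))[[t 1, t 2, …]]`.
The variable of `LaurentSeries A` stands for `λ⁻¹`. -/
abbrev TSer (A : Type*) [CommRing A] : Type _ := MvPowerSeries ℕ+ (LaurentSeries A)

variable {A : Type*} [CommRing A]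

/-- The coefficient of `t ^ α * λ ^ k`. -/
def cf (F : TSer A) (α : ℕ+ →₀ ℕ) (k : ℤ) : A := (MvPowerSeries.coeff α F).coeff (-k)

theorem ext_cf {F G : TSer A} (h : ∀ α k, cf F α k = cf G α k) : F = G := by
  refine MvPowerSeries.ext fun α => ?_
  ext n
  simpa [cf] using h α (-n)

/-- Apply `c k` to the coefficient of every `t ^ α * λ ^ k`. -/
def coeffwise (c : ℤ → A → A) (hc : ∀ k, c k 0 = 0) (F : TSer A) : TSer A :=
  fun α =>
    { coeff := fun n => c (-n) ((MvPowerSeries.coeff α F).coeff n)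
      isPWO_support' := (MvPowerSeries.coeff α F).isPWO_support.mono fun n hn h0 =>
        hn (by simp only [h0, hc]) }

theorem cf_coeffwise (c : ℤ → A → A) (hc : ∀ k, c k 0 = 0) (F : TSer A) (α : ℕ+ →₀ ℕ) (k : ℤ) :
    cf (coeffwise c hc F) α k = c k (cf F α k) := by
  change c (-(-k)) _ = _
  rw [neg_neg]
  rfl

/-- A Laurent series in `λ⁻¹` with coefficients in `A`, as a series that does not depend on the
times. -/
def const (f : LaurentSeries A) : TSer A := MvPowerSeries.C f

/-- A function of `x` alone, as a series. -/
def ofFun (a : A) : TSer A := const (HahnSeries.C a)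

/-- A power series in the times with coefficients in `A`, as a series that does not contain `λ`. -/
def ofTime (v : MvPowerSeries ℕ+ A) : TSer A := MvPowerSeries.map HahnSeries.C v

/-- The power `λ ^ k`. -/
def lam (A : Type*) [CommRing A] (k : ℤ) : TSer A := const (HahnSeries.single (-k) 1)

/-- The operator `λ ∂/∂λ`. -/
def euler (F : TSer A) : TSer A := coeffwise (fun k a => k • a) (fun _ => smul_zero _) F

/-- The projection `( )_{≥ 0}` onto nonnegative powers of `λ`. -/
def nonnegPart (F : TSer A) : TSer A :=
  coeffwise (fun k a => if 0 ≤ k then a else 0) (fun _ => ite_self _) F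

/-- The projection `( )_{≤ -1}` onto negative powers of `λ`. -/
def negPart (F : TSer A) : TSer A :=
  coeffwise (fun k a => if k ≤ -1 then a else 0) (fun _ => ite_self _) F

/-- The power `Φ ^ k` for an integer `k`, for invertible `Φ`. -/
def intPow (Φ : TSer A) : ℤ → TSer A
  | Int.ofNat n => Φ ^ n
  | Int.negSucc n => Ring.inverse Φ ^ (n + 1)

/-- `s = ∑ i, S i` coefficient by coefficient: every monomial `t ^ α * λ ^ k` occurs in finitely
many of the `S i` only, and its coefficient in `s` is the sum of those in the `S i`. -/
def HasFormalSum {ι : Type*} (S : ι → TSer A) (s : TSer A) : Prop :=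
  ∀ α k, {i | cf (S i) α k ≠ 0}.Finite ∧ cf s α k = ∑ᶠ i, cf (S i) α k

theorem HasFormalSum.unique {ι : Type*} {S : ι → TSer A} {s s' : TSer A}
    (h : HasFormalSum S s) (h' : HasFormalSum S s') : s = s' :=
  ext_cf fun α k => by rw [(h α k).2, (h' α k).2]

/-- `Φ = λ + ∑_{k ≥ 0} a k * λ ^ (-k)`. -/
def HasPhiForm (Φ : TSer A) : Prop := ∀ α (k : ℤ), 0 < k → cf (Φ - lam A 1) α k = 0

/-- A series of the form `λ + ∑_{k ≥ 0} a k * λ ^ (-k)` is invertible, so that its negative powers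
are the genuine ones. -/
theorem HasPhiForm.isUnit {Φ : TSer A} (h : HasPhiForm Φ) : IsUnit Φ := by
  rw [MvPowerSeries.isUnit_iff_constantCoeff]
  rcases subsingleton_or_nontrivial A with hA | hA
  · have : Subsingleton (LaurentSeries A) := ⟨fun f g => by ext n; exact Subsingleton.elim _ _⟩
    exact isUnit_of_subsingleton _
  set f : LaurentSeries A := MvPowerSeries.constantCoeff Φ with hf
  have hc : ∀ n : ℤ, n < 0 → f.coeff n = (HahnSeries.single (-1 : ℤ) (1 : A)).coeff n := by
    intro n hn
    have := h 0 (-n) (by omega)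
    rw [cf, map_sub, HahnSeries.coeff_sub, sub_eq_zero, neg_neg, lam, const,
      MvPowerSeries.coeff_zero_C, MvPowerSeries.coeff_zero_eq_constantCoeff_apply] at this
    exact this
  have h1 : f.coeff (-1) = 1 := by rw [hc _ (by norm_num), HahnSeries.coeff_single_same]
  have hlt : ∀ n : ℤ, n < -1 → f.coeff n = 0 := by
    intro n hn
    rw [hc n (by omega), HahnSeries.coeff_single_of_ne (by omega)]
  have hne : f ≠ 0 := by
    intro h0
    simp [h0] at h1
  have ho : f.order = -1 := by
    refine le_antisymm (HahnSeries.order_le_of_coeff_ne_zero (by simp [h1])) ?_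
    by_contra hlt'
    exact HahnSeries.coeff_order_eq_zero.not.mpr hne (hlt _ (not_le.mp hlt'))
  refine HahnSeries.isUnit_of_isUnit_leadingCoeff_AddUnitOrder ?_ ?_
  · rw [HahnSeries.leadingCoeff_eq, ho, h1]
    exact isUnit_one
  · exact AddGroup.isAddUnit _

variable [Algebra ℚ A]

/-- The product of a rational number and a series. -/
def scale (q : ℚ) (F : TSer A) : TSer A := coeffwise (fun _ a => q • a) (fun _ => smul_zero _) F

theorem cf_scale (q : ℚ) (F : TSer A) (α : ℕ+ →₀ ℕ) (k : ℤ) : cf (scale q F) α k = q • cf F α k :=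
  cf_coeffwise _ _ F α k

/-- The operator `∂/∂x`. -/
def dx (D : Derivation ℚ A A) (F : TSer A) : TSer A := coeffwise (fun _ => D) (fun _ => map_zero D) F

/-- The Poisson bracket `{F, G} = λ F_λ G_x - λ F_x G_λ`; as an operator on `G`, `bracket D F` is
`ad F`. -/
def bracket (D : Derivation ℚ A A) (F G : TSer A) : TSer A := euler F * dx D G - dx D F * euler G

/-- `G = e^{ad φ} F`, i.e. `G = ∑ j, (ad φ)^j F / j!`. -/
def IsExpAd (D : Derivation ℚ A A) (φ F G : TSer A) : Prop :=
  HasFormalSum (fun j : ℕ => scale (j.factorial : ℚ)⁻¹ ((bracket D φ)^[j] F)) G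

/-- `∇_{t n, φ} φ = G`, where `∇_{t n, φ} φ = ∑ j, (ad φ)^j (∂φ/∂t n) / (j + 1)!`. -/
def IsNabla (D : Derivation ℚ A A) (φ : TSer A) (n : ℕ+) (G : TSer A) : Prop :=
  HasFormalSum (fun j : ℕ => scale ((j + 1).factorial : ℚ)⁻¹
    ((bracket D φ)^[j] (MvPowerSeries.pderiv (LaurentSeries A) n φ))) G

/-- `F = f(Φ, Ψ)` for `f(λ, x) = ∑ k, f k (x) * λ ^ k`: `λ` is replaced by `Φ` and every `f k (x)`
by its Taylor expansion `f k (Ψ) = ∑ j, (∂ₓ^j f k) (x) * (Ψ - x) ^ j / j!` around `x`. -/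
def IsSubst (D : Derivation ℚ A A) (x : A) (f : LaurentSeries A) (Φ Ψ F : TSer A) : Prop :=
  HasFormalSum (fun p : ℤ × ℕ => scale (p.2.factorial : ℚ)⁻¹
    (ofFun (D^[p.2] (f.coeff (-p.1))) * (Ψ - ofFun x) ^ p.2 * intPow Φ p.1)) F

/-- The term `ε n * t n / n * Φ ^ n`, where `ε n` is a sign. -/
def timeTerm (ε : ℕ+ → ℤˣ) (Φ : TSer A) (n : ℕ+) : TSer A :=
  scale (((ε n : ℤ) : ℚ) / (n : ℕ)) ((MvPowerSeries.X n : TSer A) * Φ ^ (n : ℕ))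

/-- The series `∑_{n ≥ 1} ε n * t n / n * λ ^ n`. To the coefficient of `t ^ α` only the finitely
many `n` in the support of `α` contribute. -/
def timeSeries (A : Type*) [CommRing A] [Algebra ℚ A] (ε : ℕ+ → ℤˣ) : TSer A :=
  fun α => ∑ n ∈ α.support, MvPowerSeries.coeff α (timeTerm ε (lam A 1) n)

theorem hasFormalSum_timeSeries (ε : ℕ+ → ℤˣ) :
    HasFormalSum (timeTerm ε (lam A 1)) (timeSeries A ε) := by
  have hX : ∀ (α : ℕ+ →₀ ℕ) (n : ℕ+) (k : ℤ), n ∉ α.support →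
      cf (timeTerm ε (lam A 1) n) α k = 0 := by
    intro α n k hn
    have h0 : MvPowerSeries.coeff α ((MvPowerSeries.X n : TSer A) * lam A 1 ^ (n : ℕ)) = 0 := by
      rw [← pow_one (MvPowerSeries.X n : TSer A), MvPowerSeries.X_pow_eq,
        MvPowerSeries.coeff_monomial_mul, if_neg]
      intro hle
      have := hle n
      simp only [Finsupp.single_eq_same] at this
      exact hn (Finsupp.mem_support_iff.mpr (by omega))
    rw [timeTerm, cf_scale, cf, h0, HahnSeries.coeff_zero, smul_zero]
  intro α k
  have hsub : {n | cf (timeTerm ε (lam A 1) n) α k ≠ 0} ⊆ (α.support : Set ℕ+) := by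
    intro n hn
    by_contra hns
    exact hn (hX α n k hns)
  refine ⟨α.support.finite_toSet.subset hsub, ?_⟩
  rw [finsum_eq_sum_of_support_subset _ hsub]
  change (∑ n ∈ α.support, MvPowerSeries.coeff α (timeTerm ε (lam A 1) n)).coeff (-k) = _
  rw [HahnSeries.coeff_sum]
  rfl

/-- The series `x + ∑_{n ≥ 1} ε n * t n / n * λ ^ n`. -/
def bareSeries (x : A) (ε : ℕ+ → ℤˣ) : TSer A := ofFun x + timeSeries A ε

/-- The Hamiltonian `H n = ε n / n ^ 2 * (Φ ^ n)_{≥ 0}`. -/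
def hamiltonian (ε : ℕ+ → ℤˣ) (Φ : TSer A) (n : ℕ+) : TSer A :=
  scale (((ε n : ℤ) : ℚ) / (n : ℕ) ^ 2) (nonnegPart (Φ ^ (n : ℕ)))

/-- `Ψ = x + ∑_{n ≥ 1} ε n * t n / n * Φ ^ n + ∑_{i ≥ 1} v i * Φ ^ (-i)`, where the `v i` do not
contain `λ`. -/
def HasPsiForm (x : A) (ε : ℕ+ → ℤˣ) (Φ Ψ : TSer A) : Prop :=
  ∃ v : ℕ+ → MvPowerSeries ℕ+ A,
    HasFormalSum (Sum.elim (timeTerm ε Φ) fun i : ℕ+ => ofTime (v i) * intPow Φ (-(i : ℤ)))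
      (Ψ - ofFun x)

/-- `(Φ, Ψ)` is a solution of the hierarchy: the two series have the prescribed form, satisfy the
canonical relation and the Lax equations `∂Φ/∂t n = {H n, Φ}`, `∂Ψ/∂t n = {H n, Ψ}`. -/
structure IsSolution (D : Derivation ℚ A A) (x : A) (ε : ℕ+ → ℤˣ) (Φ Ψ : TSer A) : Prop where
  phi_form : HasPhiForm Φ
  psi_form : HasPsiForm x ε Φ Ψ
  canonical : bracket D Φ Ψ = Φ
  lax_phi : ∀ n : ℕ+,
    MvPowerSeries.pderiv (LaurentSeries A) n Φ = bracket D (hamiltonian ε Φ n) Φ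
  lax_psi : ∀ n : ℕ+,
    MvPowerSeries.pderiv (LaurentSeries A) n Ψ = bracket D (hamiltonian ε Φ n) Ψ

/-- `φ = ∑_{n ≥ 1} φ n (t) * λ ^ (-n)` is a dressing function of `(Φ, Ψ)`. -/
structure IsDressing (D : Derivation ℚ A A) (x : A) (ε : ℕ+ → ℤˣ) (φ Φ Ψ : TSer A) : Prop where
  neg_powers : ∀ α (k : ℤ), 0 ≤ k → cf φ α k = 0
  phi_eq : IsExpAd D φ (lam A 1) Φ
  psi_eq : IsExpAd D φ (bareSeries x ε) Ψ
  nabla_eq : ∀ n : ℕ+, ∃ E : TSer A, IsExpAd D φ (lam A n) E ∧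
    IsNabla D φ n (-scale (((ε n : ℤ) : ℚ) / (n : ℕ) ^ 2) (negPart E))

/-- `(f, g)` is a twistor structure of `(Φ, Ψ)`: `{f, g} = f`, and `f(Φ, Ψ)`, `g(Φ, Ψ)` are well
defined and contain no negative powers of `λ`. -/
def IsTwistorStructure (D : Derivation ℚ A A) (x : A) (f g : LaurentSeries A) (Φ Ψ : TSer A) :
    Prop :=
  bracket D (const f) (const g) = const f ∧
    ∃ F G : TSer A, IsSubst D x f Φ Ψ F ∧ IsSubst D x g Φ Ψ G ∧ negPart F = 0 ∧ negPart G = 0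

/-- The value of a series at `t = 0`. -/
def atZero (F : TSer A) : LaurentSeries A := MvPowerSeries.constantCoeff F

end TwistorHierarchy

end

open TwistorHierarchy

/-! The proof rests on one rigidity fact (`eq_zero_of_bracket_eq`). If X = x + O(λ⁻¹), then u ↦ {u,
X} is λ∂/∂λ plus terms of lower λ-degree. An eigenvector u with eigenvalue c whose λ-degree is below
c must therefore vanish: at its top power k the equation reads (k − c) u_k = 0.

Dressing function. Let X be Ψ minus its time terms, so X = x + O(λ⁻¹). The equation e^{ad φ} x = X
is solved by successive approximation, because the linearization {u, x} = λ∂u/∂λ is invertible on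
negative powers (`exists_expAd_eq`). Rigidity then gives the rest. Both e^{ad φ} λ and Φ satisfy {u,
X} = u with the same leading term, so they agree. The formula for Ψ follows because e^{ad φ}
commutes with the times and sends λⁿ to Φⁿ. Finally, ∂X/∂tₙ is {∇φ, X} by `dtDer_expAd`, while the
Lax equations and {Φⁿ, X} = nΦⁿ write it as a bracket of −(εₙ/n²)(Φⁿ)_{≤ -1} with X. The difference
of these two negative-power series commutes with X, hence is zero.

Twistor structure. The derivation ∂/∂tₙ − ad Hₙ kills Φ and Ψ, hence every f(Φ, Ψ)
(`derivation_subst`). Since Hₙ has no negative powers of λ, their absence at t = 0 propagates to all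
orders in t (`negPart_eq_zero_of_flow`). At t = 0 the pair is e^{ad φ₀}(λ, x), so f(Φ, Ψ) becomes
e^{ad φ₀} f by `subst_expAd`. For f = e^{-ad φ₀} λ and g = e^{-ad φ₀} x this is λ and x. The
relation {f, g} = f holds because e^{-ad φ₀} preserves the bracket (`expAd_bracket`).

Convergence is controlled by filtrations that bound the power of λ by a constant plus a weight of
the monomial in t. Weight zero suffices for φ and Φ; for Ψ, which contains tₙΦⁿ for all n, tₙ gets
weight 2n. -/

noncomputable section

namespace TwistorHierarchy

variable {A : Type*} [CommRing A]

/-! ### Coefficients of elementary series. -/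

section Coefficients

@[simp] theorem cf_zero (α : ℕ+ →₀ ℕ) (k : ℤ) : cf (0 : TSer A) α k = 0 := by simp [cf]

@[simp] theorem cf_add (F G : TSer A) (α : ℕ+ →₀ ℕ) (k : ℤ) :
    cf (F + G) α k = cf F α k + cf G α k := by simp [cf]

@[simp] theorem cf_neg (F : TSer A) (α : ℕ+ →₀ ℕ) (k : ℤ) : cf (-F) α k = -cf F α k := by
  simp [cf]

@[simp] theorem cf_sub (F G : TSer A) (α : ℕ+ →₀ ℕ) (k : ℤ) :
    cf (F - G) α k = cf F α k - cf G α k := by simp [cf]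

@[simp] theorem cf_sum {ι : Type*} (s : Finset ι) (S : ι → TSer A) (α : ℕ+ →₀ ℕ) (k : ℤ) :
    cf (∑ i ∈ s, S i) α k = ∑ i ∈ s, cf (S i) α k := by
  simp [cf, map_sum, HahnSeries.coeff_sum]

theorem cf_const (f : LaurentSeries A) (α : ℕ+ →₀ ℕ) (k : ℤ) :
    cf (const f) α k = if α = 0 then f.coeff (-k) else 0 := by
  classical
  rw [cf, const, MvPowerSeries.coeff_C]
  split_ifs <;> simp

theorem cf_ofFun (a : A) (α : ℕ+ →₀ ℕ) (k : ℤ) :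
    cf (ofFun a) α k = if α = 0 ∧ k = 0 then a else 0 := by
  rw [ofFun, cf_const]
  by_cases hα : α = 0 <;> by_cases hk : k = 0 <;> simp [hα, hk, HahnSeries.C_apply]

theorem cf_lam (m : ℤ) (α : ℕ+ →₀ ℕ) (k : ℤ) :
    cf (lam A m) α k = if α = 0 ∧ k = m then 1 else 0 := by
  rw [lam, cf_const]
  by_cases hα : α = 0 <;> by_cases hk : k = m <;> simp [hα, hk]

theorem cf_ofFun_mul (a : A) (F : TSer A) (α : ℕ+ →₀ ℕ) (k : ℤ) :
    cf (ofFun a * F) α k = a * cf F α k := by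
  rw [cf, ofFun, const, MvPowerSeries.coeff_C_mul, HahnSeries.C_apply,
    HahnSeries.coeff_single_zero_mul]
  rfl

theorem cf_mul_lam (F : TSer A) (m : ℤ) (α : ℕ+ →₀ ℕ) (k : ℤ) :
    cf (F * lam A m) α k = cf F α (k - m) := by
  rw [cf, lam, const, MvPowerSeries.coeff_mul_C, HahnSeries.coeff_mul_single, mul_one, cf]
  congr 1
  ring

theorem lam_zero : lam A 0 = 1 := by
  simp [lam, const]

theorem lam_mul_lam (m n : ℤ) : lam A m * lam A n = lam A (m + n) := by
  refine ext_cf fun α k => ?_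
  rw [cf_mul_lam, cf_lam, cf_lam]
  congr 1
  rw [sub_eq_iff_eq_add]

theorem lam_pow (m : ℤ) (n : ℕ) : lam A m ^ n = lam A (n * m) := by
  induction n with
  | zero => simp [lam_zero]
  | succ n ih =>
    rw [pow_succ, ih, lam_mul_lam]
    congr 1
    push_cast
    ring

theorem ofFun_one : ofFun (1 : A) = 1 := by simp [ofFun, const]

end Coefficients

/-! ### Leibniz rule for coefficientwise operators. -/

section Coeffwise

/-- Apply `c k` to the coefficient of every `λ ^ k`. -/
def laurentMap (c : ℤ → A → A) (hc : ∀ k, c k 0 = 0) (f : LaurentSeries A) : LaurentSeries A where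
  coeff n := c (-n) (f.coeff n)
  isPWO_support' := f.isPWO_support.mono fun n hn h0 => hn (by simp only [h0, hc])

theorem coeff_coeffwise (c : ℤ → A → A) (hc : ∀ k, c k 0 = 0) (F : TSer A) (α : ℕ+ →₀ ℕ) :
    MvPowerSeries.coeff α (coeffwise c hc F) = laurentMap c hc (MvPowerSeries.coeff α F) := rfl

/-- The graded Leibniz condition `hmul` covers λ∂/∂λ (multiplication by the exponent) and ∂/∂x
(exponent ignored) at once. Supports can only shrink, so all three products can be summed over one
antidiagonal. -/
theorem laurentMap_mul (c : ℤ → A → A) (hc : ∀ k, c k 0 = 0)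
    (hadd : ∀ k a b, c k (a + b) = c k a + c k b)
    (hmul : ∀ i j a b, c (i + j) (a * b) = c i a * b + a * c j b) (f g : LaurentSeries A) :
    laurentMap c hc (f * g) = laurentMap c hc f * g + f * laurentMap c hc g := by
  have hf : (laurentMap c hc f).support ⊆ f.support := fun n hn h0 => hn (by
    change c (-n) (f.coeff n) = 0
    rw [h0, hc])
  have hg : (laurentMap c hc g).support ⊆ g.support := fun n hn h0 => hn (by
    change c (-n) (g.coeff n) = 0
    rw [h0, hc])
  ext n
  rw [HahnSeries.coeff_add, HahnSeries.coeff_mul_left' f.isPWO_support hf,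
    HahnSeries.coeff_mul_right' g.isPWO_support hg, ← Finset.sum_add_distrib]
  change c (-n) ((f * g).coeff n) = _
  rw [HahnSeries.coeff_mul]
  let C : A →+ A := AddMonoidHom.mk' (c (-n)) (hadd (-n))
  change C (∑ _ ∈ _, _) = _
  rw [map_sum]
  refine Finset.sum_congr rfl fun p hp => ?_
  rw [Finset.mem_antidiagonal] at hp
  change c (-n) (f.coeff p.1 * g.coeff p.2) = _
  rw [← hp.2.2, neg_add, hmul]
  rfl

theorem coeffwise_mul (c : ℤ → A → A) (hc : ∀ k, c k 0 = 0)
    (hadd : ∀ k a b, c k (a + b) = c k a + c k b)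
    (hmul : ∀ i j a b, c (i + j) (a * b) = c i a * b + a * c j b) (F G : TSer A) :
    coeffwise c hc (F * G) = coeffwise c hc F * G + F * coeffwise c hc G := by
  classical
  refine MvPowerSeries.ext fun α => ?_
  have hs : ∀ f g, laurentMap c hc (f + g) = laurentMap c hc f + laurentMap c hc g := by
    intro f g
    ext n
    exact hadd _ _ _
  let C : LaurentSeries A →+ LaurentSeries A := AddMonoidHom.mk' (laurentMap c hc) hs
  rw [coeff_coeffwise, map_add, MvPowerSeries.coeff_mul, MvPowerSeries.coeff_mul,
    MvPowerSeries.coeff_mul, ← Finset.sum_add_distrib]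
  change C _ = _
  rw [map_sum]
  refine Finset.sum_congr rfl fun p _ => ?_
  exact laurentMap_mul c hc hadd hmul _ _

end Coeffwise

theorem cf_euler (F : TSer A) (α : ℕ+ →₀ ℕ) (k : ℤ) : cf (euler F) α k = k • cf F α k :=
  cf_coeffwise _ _ F α k

theorem cf_negPart (F : TSer A) (α : ℕ+ →₀ ℕ) (k : ℤ) :
    cf (negPart F) α k = if k ≤ -1 then cf F α k else 0 :=
  cf_coeffwise _ _ F α k

theorem cf_nonnegPart (F : TSer A) (α : ℕ+ →₀ ℕ) (k : ℤ) :
    cf (nonnegPart F) α k = if 0 ≤ k then cf F α k else 0 :=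
  cf_coeffwise _ _ F α k

theorem negPart_add_nonnegPart (F : TSer A) : negPart F + nonnegPart F = F := by
  refine ext_cf fun α k => ?_
  rw [cf_add, cf_negPart, cf_nonnegPart]
  by_cases h : 0 ≤ k
  · rw [if_neg (by omega), if_pos h, zero_add]
  · rw [if_pos (by omega), if_neg h, add_zero]

variable [Algebra ℚ A]

/-- Fixes the coefficientwise action of ℚ, so that `cf_smul` holds by definition. -/
instance instAlgebraLaurent : Algebra ℚ (LaurentSeries A) := HahnSeries.instAlgebra

instance instAlgebraTSer : Algebra ℚ (TSer A) := MvPowerSeries.instAlgebra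

theorem cf_smul (q : ℚ) (F : TSer A) (α : ℕ+ →₀ ℕ) (k : ℤ) : cf (q • F) α k = q • cf F α k := rfl

theorem scale_eq_smul (q : ℚ) (F : TSer A) : scale q F = q • F :=
  ext_cf fun α k => by rw [cf_scale, cf_smul]

theorem cf_dx (D : Derivation ℚ A A) (F : TSer A) (α : ℕ+ →₀ ℕ) (k : ℤ) :
    cf (dx D F) α k = D (cf F α k) :=
  cf_coeffwise _ _ F α k

theorem cf_pderiv (n : ℕ+) (F : TSer A) (α : ℕ+ →₀ ℕ) (k : ℤ) :
    cf (MvPowerSeries.pderiv (LaurentSeries A) n F) α k =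
      ((α n + 1 : ℕ) : ℚ) • cf F (α + Finsupp.single n 1) k := by
  rw [cf, MvPowerSeries.coeff_pderiv, cf, mul_comm, ← Nat.cast_succ, ← nsmul_eq_mul,
    Nat.cast_smul_eq_nsmul ℚ]
  rfl

/-! ### The Poisson algebra and its derivations. -/

section Derivations

/-- `λ ∂/∂λ` as a derivation. -/
def eulerDer (A : Type*) [CommRing A] [Algebra ℚ A] : Derivation ℚ (TSer A) (TSer A) :=
  Derivation.mk'
    { toFun := euler
      map_add' := fun F G => ext_cf fun α k => by simp only [cf_euler, cf_add, smul_add]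
      map_smul' := fun q F => ext_cf fun α k => by
        simp only [cf_euler, cf_smul, RingHom.id_apply]
        exact smul_comm _ _ _ }
    fun F G => by
      change euler (F * G) = F * euler G + G * euler F
      rw [euler, coeffwise_mul]
      · rw [euler, euler]
        ring
      · exact fun k a b => smul_add k a b
      · intro i j a b
        simp only [zsmul_eq_mul]
        push_cast
        ring

/-- `∂/∂x` as a derivation. -/
def dxDer (D : Derivation ℚ A A) : Derivation ℚ (TSer A) (TSer A) :=
  Derivation.mk'
    { toFun := dx D
      map_add' := fun F G => ext_cf fun α k => by simp only [cf_dx, cf_add, map_add]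
      map_smul' := fun q F => ext_cf fun α k => by
        simp only [cf_dx, cf_smul, RingHom.id_apply, Derivation.map_smul] }
    fun F G => by
      change dx D (F * G) = F * dx D G + G * dx D F
      rw [dx, coeffwise_mul]
      · rw [dx, dx]
        ring
      · exact fun k a b => map_add D a b
      · intro i j a b
        rw [Derivation.leibniz, smul_eq_mul, smul_eq_mul]
        ring

/-- `∂/∂t n` as a derivation over `ℚ`. -/
def dtDer (A : Type*) [CommRing A] [Algebra ℚ A] (n : ℕ+) : Derivation ℚ (TSer A) (TSer A) :=
  Derivation.mk'
    { toFun := MvPowerSeries.pderiv (LaurentSeries A) n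
      map_add' := map_add _
      map_smul' := fun q F => ext_cf fun α k => by
        simp only [cf_pderiv, cf_smul, RingHom.id_apply]
        exact smul_comm _ _ _ }
    (Derivation.leibniz (MvPowerSeries.pderiv (LaurentSeries A) n))

theorem dtDer_apply (n : ℕ+) (F : TSer A) :
    dtDer A n F = MvPowerSeries.pderiv (LaurentSeries A) n F := rfl

theorem cf_dtDer (n : ℕ+) (F : TSer A) (α : ℕ+ →₀ ℕ) (k : ℤ) :
    cf (dtDer A n F) α k = ((α n + 1 : ℕ) : ℚ) • cf F (α + Finsupp.single n 1) k :=
  cf_pderiv n F α k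

/-- `ad F` as a derivation. -/
def adDer (D : Derivation ℚ A A) (F : TSer A) : Derivation ℚ (TSer A) (TSer A) :=
  euler F • dxDer D - dx D F • eulerDer A

theorem adDer_apply (D : Derivation ℚ A A) (F G : TSer A) : adDer D F G = bracket D F G := rfl

variable (D : Derivation ℚ A A)

theorem euler_dx (F : TSer A) : euler (dx D F) = dx D (euler F) :=
  ext_cf fun α k => by simp only [cf_euler, cf_dx, map_zsmul]

theorem dtDer_euler (n : ℕ+) (F : TSer A) : dtDer A n (euler F) = euler (dtDer A n F) :=
  ext_cf fun α k => by
    simp only [cf_euler, cf_dtDer]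
    exact smul_comm _ _ _

theorem dtDer_dx (n : ℕ+) (F : TSer A) : dtDer A n (dx D F) = dx D (dtDer A n F) :=
  ext_cf fun α k => by simp only [cf_dx, cf_dtDer, Derivation.map_smul]

theorem euler_mul (F G : TSer A) : euler (F * G) = F * euler G + G * euler F :=
  (eulerDer A).leibniz F G

theorem dx_mul (F G : TSer A) : dx D (F * G) = F * dx D G + G * dx D F :=
  (dxDer D).leibniz F G

theorem euler_add (F G : TSer A) : euler (F + G) = euler F + euler G := map_add (eulerDer A) F G
theorem euler_sub (F G : TSer A) : euler (F - G) = euler F - euler G := map_sub (eulerDer A) F G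
theorem dx_add (F G : TSer A) : dx D (F + G) = dx D F + dx D G := map_add (dxDer D) F G
theorem dx_sub (F G : TSer A) : dx D (F - G) = dx D F - dx D G := map_sub (dxDer D) F G

theorem bracket_sub_right (F G H : TSer A) :
    bracket D F (G - H) = bracket D F G - bracket D F H := map_sub (adDer D F) G H

theorem bracket_smul_right (F G : TSer A) (q : ℚ) :
    bracket D F (q • G) = q • bracket D F G := (adDer D F).map_smul q G

theorem bracket_skew (F G : TSer A) : bracket D F G = -bracket D G F := by
  simp only [bracket]
  ring

theorem bracket_add_left (F G H : TSer A) :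
    bracket D (F + G) H = bracket D F H + bracket D G H := by
  simp only [bracket, euler_add, dx_add]
  ring

theorem bracket_sub_left (F G H : TSer A) :
    bracket D (F - G) H = bracket D F H - bracket D G H := by
  simp only [bracket, euler_sub, dx_sub]
  ring

theorem bracket_smul_left (F G : TSer A) (q : ℚ) :
    bracket D (q • F) G = q • bracket D F G := by
  rw [bracket_skew, bracket_smul_right, bracket_skew D F G, smul_neg]

theorem bracket_neg_left (F G : TSer A) : bracket D (-F) G = -bracket D F G := by
  rw [bracket_skew, ← adDer_apply, map_neg, adDer_apply, ← bracket_skew, bracket_skew]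

theorem bracket_sum_right {ι : Type*} (s : Finset ι) (F : TSer A) (S : ι → TSer A) :
    bracket D F (∑ i ∈ s, S i) = ∑ i ∈ s, bracket D F (S i) := map_sum (adDer D F) S s

@[simp] theorem bracket_zero_right (F : TSer A) : bracket D F 0 = 0 := map_zero (adDer D F)

@[simp] theorem bracket_zero_left (F : TSer A) : bracket D 0 F = 0 := by
  rw [bracket_skew, bracket_zero_right, neg_zero]

theorem bracket_mul_right (F G H : TSer A) :
    bracket D F (G * H) = G * bracket D F H + H * bracket D F G := (adDer D F).leibniz G H

/-- Follows from the Leibniz rules and the commutation of λ∂/∂λ with ∂/∂x. -/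
theorem bracket_jacobi (F G H : TSer A) :
    bracket D F (bracket D G H) =
      bracket D (bracket D F G) H + bracket D G (bracket D F H) := by
  simp only [bracket, euler_sub, dx_sub, euler_mul, dx_mul, euler_dx]
  ring

theorem dtDer_bracket (n : ℕ+) (F G : TSer A) :
    dtDer A n (bracket D F G) = bracket D (dtDer A n F) G + bracket D F (dtDer A n G) := by
  simp only [bracket, map_sub, Derivation.leibniz, smul_eq_mul, dtDer_euler, dtDer_dx]
  ring

omit [Algebra ℚ A] in
theorem euler_ofFun (a : A) : euler (ofFun a) = 0 := ext_cf fun α k => by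
  rw [cf_euler, cf_ofFun, cf_zero]
  split_ifs with h
  · rw [h.2, zero_smul]
  · rw [smul_zero]

theorem dx_ofFun (a : A) : dx D (ofFun a) = ofFun (D a) := ext_cf fun α k => by
  rw [cf_dx, cf_ofFun, cf_ofFun]
  split_ifs <;> simp

theorem euler_lam (m : ℤ) : euler (lam A m) = (m : ℚ) • lam A m := ext_cf fun α k => by
  rw [cf_euler, cf_smul, cf_lam, Int.cast_smul_eq_zsmul]
  split_ifs with h
  · rw [h.2]
  · simp

theorem dtDer_ofFun (n : ℕ+) (a : A) : dtDer A n (ofFun a) = 0 := by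
  rw [dtDer_apply, ofFun, const, MvPowerSeries.pderiv_C]

theorem bracket_ofFun_right (F : TSer A) (a : A) :
    bracket D F (ofFun a) = euler F * ofFun (D a) := by
  rw [bracket, euler_ofFun, dx_ofFun, mul_zero, sub_zero]

end Derivations

end TwistorHierarchy

end

/-! ### Filtrations and convergent sums. -/

noncomputable section

namespace TwistorHierarchy

variable {A : Type*} [CommRing A]

/-- Series whose coefficient of `t ^ α * λ ^ k` vanishes for `k > N + w α`. -/
def bd (A : Type*) [CommRing A] (w : (ℕ+ →₀ ℕ) →+ ℤ) (N : ℤ) : AddSubgroup (TSer A) where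
  carrier := {F | ∀ α k, N + w α < k → cf F α k = 0}
  zero_mem' := fun α k _ => cf_zero α k
  add_mem' := fun {F G} hF hG α k h => by rw [cf_add, hF α k h, hG α k h, add_zero]
  neg_mem' := fun {F} hF α k h => by rw [cf_neg, hF α k h, neg_zero]

variable {w : (ℕ+ →₀ ℕ) →+ ℤ} {M N : ℤ}

theorem mem_bd {F : TSer A} : F ∈ bd A w N ↔ ∀ α k, N + w α < k → cf F α k = 0 := Iff.rfl

theorem mem_bd_zero {F : TSer A} : F ∈ bd A 0 N ↔ ∀ α k, N < k → cf F α k = 0 := by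
  simp [mem_bd]

theorem bd_mono (h : M ≤ N) {F : TSer A} (hF : F ∈ bd A w M) : F ∈ bd A w N :=
  fun α k hk => hF α k (by omega)

theorem bd_weight_mono (hw : ∀ α, 0 ≤ w α) {F : TSer A} (hF : F ∈ bd A 0 N) : F ∈ bd A w N :=
  fun α k hk => mem_bd_zero.mp hF α k (by have := hw α; omega)

theorem bd_mul {F G : TSer A} (hF : F ∈ bd A w M) (hG : G ∈ bd A w N) :
    F * G ∈ bd A w (M + N) := by
  classical
  intro α k hk
  rw [cf, MvPowerSeries.coeff_mul, HahnSeries.coeff_sum]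
  refine Finset.sum_eq_zero fun p hp => ?_
  rw [Finset.HasAntidiagonal.mem_antidiagonal] at hp
  rw [HahnSeries.coeff_mul]
  refine Finset.sum_eq_zero fun q hq => ?_
  rw [Finset.mem_antidiagonal] at hq
  rw [← hp, map_add] at hk
  rcases lt_or_ge (M + w p.1) (-q.1) with h | h
  · have := hF p.1 (-q.1) h
    rw [cf, neg_neg] at this
    rw [this, zero_mul]
  · have := hG p.2 (-q.2) (by have := hq.2.2; omega)
    rw [cf, neg_neg] at this
    rw [this, mul_zero]

/-- The filtration is separated; identities between infinite sums are proved by bounding their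
difference to every order. -/
theorem bd_eq_zero {F : TSer A} (N : ℤ) (h : ∀ J : ℕ, F ∈ bd A w (N - J)) : F = 0 :=
  ext_cf fun α k => by
    rw [cf_zero]
    exact h (N + w α - k + 1).toNat α k (by omega)

theorem ofFun_mem_bd (hw : ∀ α, 0 ≤ w α) (a : A) : ofFun a ∈ bd A w 0 := fun α k hk => by
  rw [cf_ofFun, if_neg]
  rintro ⟨-, rfl⟩
  have := hw α
  omega

theorem lam_mem_bd (hw : ∀ α, 0 ≤ w α) (m : ℤ) : lam A m ∈ bd A w m := fun α k hk => by
  rw [cf_lam, if_neg]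
  rintro ⟨-, rfl⟩
  have := hw α
  omega

theorem one_mem_bd (hw : ∀ α, 0 ≤ w α) : (1 : TSer A) ∈ bd A w 0 := by
  rw [← ofFun_one]
  exact ofFun_mem_bd hw 1

theorem bd_pow (hw : ∀ α, 0 ≤ w α) {F : TSer A} (hF : F ∈ bd A w N) (n : ℕ) :
    F ^ n ∈ bd A w (n * N) := by
  induction n with
  | zero => simpa using one_mem_bd hw
  | succ n ih =>
    rw [pow_succ]
    refine bd_mono ?_ (bd_mul ih hF)
    push_cast
    linarith

theorem bd_pow_sub_pow (hw : ∀ α, 0 ≤ w α) {F G : TSer A} (hF : F ∈ bd A w N) (hG : G ∈ bd A w N)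
    (h : F - G ∈ bd A w (N - 1)) (n : ℕ) : F ^ n - G ^ n ∈ bd A w (n * N - 1) := by
  induction n with
  | zero => simp
  | succ n ih =>
    have : F ^ (n + 1) - G ^ (n + 1) = F ^ n * (F - G) + (F ^ n - G ^ n) * G := by ring
    rw [this]
    refine add_mem (bd_mono ?_ (bd_mul (bd_pow hw hF n) h)) (bd_mono ?_ (bd_mul ih hG)) <;>
    · push_cast
      linarith

theorem bd_euler {F : TSer A} (hF : F ∈ bd A w N) : euler F ∈ bd A w N := fun α k hk => by
  rw [cf_euler, hF α k hk, smul_zero]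

section FormalSums

/-- `s = ∑ j, S j`, where the remainder after `J` terms belongs to `bd A w (N - J)`. -/
def Sums (w : (ℕ+ →₀ ℕ) →+ ℤ) (N : ℤ) (S : ℕ → TSer A) (s : TSer A) : Prop :=
  ∀ J : ℕ, s - ∑ j ∈ Finset.range J, S j ∈ bd A w (N - J)

variable {S : ℕ → TSer A} {s : TSer A}

theorem Sums.mem (h : Sums w N S s) : s ∈ bd A w N := by simpa using h 0

theorem Sums.cf_eq (h : Sums w N S s) {J : ℕ} {α : ℕ+ →₀ ℕ} {k : ℤ} (hJ : N - J + w α < k) :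
    cf s α k = ∑ j ∈ Finset.range J, cf (S j) α k := by
  have := h J α k hJ
  rwa [cf_sub, cf_sum, sub_eq_zero] at this

theorem Sums.term_mem (h : Sums w N S s) (j : ℕ) : S j ∈ bd A w (N - j) := by
  have h1 := sub_mem (h j) (bd_mono (by push_cast; linarith) (h (j + 1)))
  rw [Finset.sum_range_succ] at h1
  convert h1 using 1
  abel

theorem Sums.hasFormalSum (h : Sums w N S s) : HasFormalSum S s := by
  intro α k
  have hsub : (Function.support fun j => cf (S j) α k) ⊆
      (Finset.range (N + w α - k + 1).toNat : Set ℕ) := by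
    intro j hj
    rw [Finset.coe_range, Set.mem_Iio]
    by_contra hlt
    exact hj (h.term_mem j α k (by omega))
  refine ⟨(Finset.finite_toSet _).subset hsub, ?_⟩
  rw [finsum_eq_sum_of_support_subset _ hsub]
  exact h.cf_eq (by omega)

/-- The filtration is complete: a given monomial only meets finitely many terms, and for fixed α the
powers of λ stay below N + w α, so each coefficient is a Laurent series. -/
theorem exists_sums (h : ∀ j : ℕ, S j ∈ bd A w (N - j)) : ∃ s, Sums w N S s := by
  let s : TSer A := fun α =>
    { coeff := fun n => ∑ j ∈ Finset.range (N + w α + n + 1).toNat, cf (S j) α (-n)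
      isPWO_support' := by
        refine Set.IsWF.isPWO (BddBelow.isWF ⟨-(N + w α), fun n hn => ?_⟩)
        by_contra hlt
        refine hn (Finset.sum_eq_zero fun j hj => ?_)
        rw [Finset.mem_range] at hj
        omega }
  have hs : ∀ α k, cf s α k = ∑ j ∈ Finset.range (N + w α - k + 1).toNat, cf (S j) α k := by
    intro α k
    change ∑ j ∈ Finset.range (N + w α + -k + 1).toNat, cf (S j) α (- -k) = _
    rw [neg_neg, ← sub_eq_add_neg]
  refine ⟨s, fun J α k hk => ?_⟩
  rw [cf_sub, cf_sum, hs, sub_eq_zero]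
  refine Finset.sum_subset (fun j hj => ?_) fun j _ hj => ?_
  · rw [Finset.mem_range] at hj ⊢
    omega
  · rw [Finset.mem_range] at hj
    exact h j α k (by omega)

/-- The sum of a sequence of series, or `0` if it does not exist. -/
def fsum (S : ℕ → TSer A) : TSer A :=
  open Classical in if h : ∃ s, HasFormalSum S s then h.choose else 0

/-- `fsum` refers to no filtration, so one and the same series may be estimated with several
weights. -/
theorem sums_fsum (h : ∀ j : ℕ, S j ∈ bd A w (N - j)) : Sums w N S (fsum S) := by
  obtain ⟨s, hs⟩ := exists_sums h
  have hex : ∃ s, HasFormalSum S s := ⟨s, hs.hasFormalSum⟩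
  have : fsum S = s := by
    rw [fsum, dif_pos hex]
    exact hex.choose_spec.unique hs.hasFormalSum
  rwa [this]

theorem Sums.unique {w' : (ℕ+ →₀ ℕ) →+ ℤ} {N' : ℤ} {s' : TSer A} (h : Sums w N S s)
    (h' : Sums w' N' S s') : s = s' := h.hasFormalSum.unique h'.hasFormalSum

theorem Sums.map {L : TSer A →+ TSer A} {c : ℤ}
    (hL : ∀ N F, F ∈ bd A w N → L F ∈ bd A w (c + N)) (h : Sums w N S s) :
    Sums w (c + N) (fun j => L (S j)) (L s) := fun J => by
  rw [← map_sum, ← map_sub, add_sub_assoc]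
  exact hL _ _ (h J)

theorem Sums.add {S' : ℕ → TSer A} {s' : TSer A} (h : Sums w N S s) (h' : Sums w N S' s') :
    Sums w N (fun j => S j + S' j) (s + s') := fun J => by
  rw [Finset.sum_add_distrib, add_sub_add_comm]
  exact add_mem (h J) (h' J)

theorem Sums.mono (hMN : M ≤ N) (h : Sums w M S s) : Sums w N S s :=
  fun J => bd_mono (by omega) (h J)

theorem Sums.eq_zero_of_forall (h : Sums w N S s) (h0 : ∀ j, S j = 0) : s = 0 :=
  bd_eq_zero N fun J => by simpa [h0] using h J

/-- A double series may be summed along the diagonals. -/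
theorem Sums.diagonal {S : ℕ → ℕ → TSer A} {r : ℕ → TSer A}
    (hr : ∀ i : ℕ, Sums w (N - i) (S i) (r i)) (hs : Sums w N r s) :
    Sums w N (fun m => ∑ i ∈ Finset.range (m + 1), S i (m - i)) s := by
  intro J
  rw [Finset.sum_range_diag_flip]
  -- Row i starts in degree N − i and is cut after J − i terms, so every row has a remainder of
  -- degree N − J.
  have h1 : ∑ i ∈ Finset.range J, (r i - ∑ j ∈ Finset.range (J - i), S i j) ∈ bd A w (N - J) := by
    refine sum_mem fun i hi => bd_mono ?_ (hr i (J - i))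
    rw [Finset.mem_range] at hi
    omega
  rw [Finset.sum_sub_distrib] at h1
  convert add_mem (hs J) h1 using 1
  abel

end FormalSums

variable [Algebra ℚ A]

theorem bd_smul (q : ℚ) {F : TSer A} (hF : F ∈ bd A w N) : q • F ∈ bd A w N := fun α k hk => by
  rw [cf_smul, hF α k hk, smul_zero]

variable (D : Derivation ℚ A A)

theorem bd_dx {F : TSer A} (hF : F ∈ bd A w N) : dx D F ∈ bd A w N := fun α k hk => by
  rw [cf_dx, hF α k hk, map_zero]

theorem bd_bracket {F G : TSer A} (hF : F ∈ bd A w M) (hG : G ∈ bd A w N) :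
    bracket D F G ∈ bd A w (M + N) :=
  sub_mem (bd_mul (bd_euler hF) (bd_dx D hG)) (bd_mul (bd_dx D hF) (bd_euler hG))

theorem bd_dtDer (n : ℕ+) {F : TSer A} (hF : F ∈ bd A w N) :
    dtDer A n F ∈ bd A w (w (Finsupp.single n 1) + N) := fun α k hk => by
  rw [cf_dtDer, hF _ _ (by rw [map_add]; omega), smul_zero]

variable {D}
variable {S : ℕ → TSer A} {s : TSer A}

theorem Sums.bracket {F : TSer A} (hF : F ∈ bd A w M) (h : Sums w N S s) :
    Sums w (M + N) (fun j => bracket D F (S j)) (bracket D F s) :=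
  h.map (L := (adDer D F).toLinearMap.toAddMonoidHom) fun _ _ hG => bd_bracket D hF hG

theorem Sums.bracket_left {F : TSer A} (hF : F ∈ bd A w M) (h : Sums w N S s) :
    Sums w (M + N) (fun j => TwistorHierarchy.bracket D (S j) F)
      (TwistorHierarchy.bracket D s F) := by
  have := h.map (L := -(adDer D F).toLinearMap.toAddMonoidHom) (c := M)
    fun _ _ hG => neg_mem (bd_bracket D hF hG)
  convert this using 1
  · funext j
    exact bracket_skew D _ _
  · exact bracket_skew D _ _

omit [Algebra ℚ A] in
theorem Sums.mul_left {F : TSer A} (hF : F ∈ bd A w M) (h : Sums w N S s) :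
    Sums w (M + N) (fun j => F * S j) (F * s) :=
  h.map (L := AddMonoidHom.mulLeft F) fun _ _ hG => bd_mul hF hG

omit [Algebra ℚ A] in
theorem Sums.mul_right {F : TSer A} (hF : F ∈ bd A w M) (h : Sums w N S s) :
    Sums w (M + N) (fun j => S j * F) (s * F) := by
  simpa only [mul_comm F] using h.mul_left hF

theorem Sums.dtDer (n : ℕ+) (h : Sums w N S s) :
    Sums w (w (Finsupp.single n 1) + N) (fun j => dtDer A n (S j)) (dtDer A n s) :=
  h.map (L := (TwistorHierarchy.dtDer A n).toLinearMap.toAddMonoidHom) fun _ _ hG => bd_dtDer n hG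

end TwistorHierarchy

end

/-! ### The exponential e^{ad φ}. -/

noncomputable section

namespace TwistorHierarchy

variable {A : Type*} [CommRing A] [Algebra ℚ A] (D : Derivation ℚ A A)
  {w : (ℕ+ →₀ ℕ) →+ ℤ} {M N : ℤ}

/-- `ad φ` as a linear map. -/
def adLin (φ : TSer A) : TSer A →ₗ[ℚ] TSer A := (adDer D φ).toLinearMap

theorem adLin_apply (φ F : TSer A) : adLin D φ F = bracket D φ F := rfl

theorem adLin_neg (φ : TSer A) : adLin D (-φ) = -adLin D φ :=
  LinearMap.ext fun F => bracket_neg_left D φ F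

theorem adLin_pow_apply (φ F : TSer A) (j : ℕ) :
    (adLin D φ ^ j) F = (bracket D φ)^[j] F := by
  rw [Module.End.pow_apply]
  rfl

theorem adLin_pow_succ_apply (φ F : TSer A) (j : ℕ) :
    (adLin D φ ^ (j + 1)) F = bracket D φ ((adLin D φ ^ j) F) := by
  rw [pow_succ']
  rfl

/-- The term `(ad φ) ^ j / j!` of the exponential series. -/
def expTerm (φ : TSer A) (j : ℕ) : TSer A →ₗ[ℚ] TSer A :=
  (j.factorial : ℚ)⁻¹ • adLin D φ ^ j

/-- `e ^ {ad φ} F`. -/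
def expAd (φ F : TSer A) : TSer A := fsum fun j => expTerm D φ j F

theorem expTerm_zero (φ F : TSer A) : expTerm D φ 0 F = F := by simp [expTerm]

theorem expTerm_one (φ F : TSer A) : expTerm D φ 1 F = bracket D φ F := by
  simp [expTerm, adLin_apply]

theorem expTerm_apply (φ F : TSer A) (j : ℕ) :
    expTerm D φ j F = scale (j.factorial : ℚ)⁻¹ ((bracket D φ)^[j] F) := by
  rw [scale_eq_smul, ← adLin_pow_apply]
  rfl

/-- The recursion that characterizes the exponential series; the identities below compare recursions
rather than manipulate factorials. -/
theorem expTerm_succ (φ F : TSer A) (j : ℕ) :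
    bracket D φ (expTerm D φ j F) = ((j + 1 : ℕ) : ℚ) • expTerm D φ (j + 1) F := by
  have h : (((j + 1).factorial : ℚ))⁻¹ = ((j + 1 : ℕ) : ℚ)⁻¹ * ((j.factorial : ℚ))⁻¹ := by
    rw [Nat.factorial_succ, Nat.cast_mul, mul_inv]
  have hj : ((j + 1 : ℕ) : ℚ) ≠ 0 := by positivity
  simp only [expTerm, LinearMap.smul_apply]
  rw [adLin_pow_succ_apply, bracket_smul_right, smul_smul, h, mul_inv_cancel_left₀ hj]

variable {D} {φ : TSer A}

theorem bd_adLin_pow (hφ : φ ∈ bd A w (-1)) {F : TSer A} (hF : F ∈ bd A w N) (j : ℕ) :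
    (adLin D φ ^ j) F ∈ bd A w (N - j) := by
  induction j with
  | zero => simpa using hF
  | succ j ih =>
    rw [adLin_pow_succ_apply]
    exact bd_mono (by push_cast; linarith) (bd_bracket D hφ ih)

theorem bd_expTerm (hφ : φ ∈ bd A w (-1)) {F : TSer A} (hF : F ∈ bd A w N) (j : ℕ) :
    expTerm D φ j F ∈ bd A w (N - j) := bd_smul _ (bd_adLin_pow hφ hF j)

theorem sums_expAd (hφ : φ ∈ bd A w (-1)) {F : TSer A} (hF : F ∈ bd A w N) :
    Sums w N (fun j => expTerm D φ j F) (expAd D φ F) := sums_fsum (bd_expTerm hφ hF)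

theorem bd_expAd (hφ : φ ∈ bd A w (-1)) {F : TSer A} (hF : F ∈ bd A w N) :
    expAd D φ F ∈ bd A w N := (sums_expAd hφ hF).mem

theorem isExpAd_expAd (hφ : φ ∈ bd A w (-1)) {F : TSer A} (hF : F ∈ bd A w N) :
    IsExpAd D φ F (expAd D φ F) := by
  have := (sums_expAd (D := D) hφ hF).hasFormalSum
  simp only [expTerm_apply] at this
  exact this

theorem IsExpAd.eq_expAd (hφ : φ ∈ bd A w (-1)) {F G : TSer A} (hF : F ∈ bd A w N)
    (h : IsExpAd D φ F G) : G = expAd D φ F := HasFormalSum.unique h (isExpAd_expAd hφ hF)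

theorem expAd_sub_self_mem (hφ : φ ∈ bd A w (-1)) {F : TSer A} (hF : F ∈ bd A w N) :
    expAd D φ F - F ∈ bd A w (N - 1) := by
  simpa [expTerm_zero] using sums_expAd (D := D) hφ hF 1

theorem expAd_add (hφ : φ ∈ bd A w (-1)) {F G : TSer A} (hF : F ∈ bd A w N)
    (hG : G ∈ bd A w N) : expAd D φ (F + G) = expAd D φ F + expAd D φ G := by
  refine (sums_expAd hφ (add_mem hF hG)).unique (?_ : Sums w N _ _)
  simpa only [map_add] using (sums_expAd (D := D) hφ hF).add (sums_expAd hφ hG)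

theorem expAd_sub (hφ : φ ∈ bd A w (-1)) {F G : TSer A} (hF : F ∈ bd A w N)
    (hG : G ∈ bd A w N) : expAd D φ (F - G) = expAd D φ F - expAd D φ G := by
  rw [eq_sub_iff_add_eq, ← expAd_add hφ (sub_mem hF hG) hG, sub_add_cancel]

theorem expAd_sum (hφ : φ ∈ bd A w (-1)) {ι : Type*} (s : Finset ι) {S : ι → TSer A}
    (hS : ∀ i ∈ s, S i ∈ bd A w N) : expAd D φ (∑ i ∈ s, S i) = ∑ i ∈ s, expAd D φ (S i) := by
  classical
  induction s using Finset.induction_on with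
  | empty =>
    rw [Finset.sum_empty, Finset.sum_empty]
    refine (sums_expAd (D := D) hφ (zero_mem (bd A w 0))).eq_zero_of_forall fun j => map_zero _
  | insert a s ha ih =>
    rw [Finset.sum_insert ha, Finset.sum_insert ha,
      expAd_add hφ (hS a (Finset.mem_insert_self a s))
        (sum_mem fun i hi => hS i (Finset.mem_insert_of_mem hi)),
      ih fun i hi => hS i (Finset.mem_insert_of_mem hi)]

theorem expAd_smul (hφ : φ ∈ bd A w (-1)) {F : TSer A} (hF : F ∈ bd A w N) (q : ℚ) :
    expAd D φ (q • F) = q • expAd D φ F := by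
  refine (sums_expAd hφ (bd_smul q hF)).unique (?_ : Sums w (0 + N) _ _)
  simp only [map_smul]
  exact (sums_expAd (D := D) hφ hF).map (L := (LinearMap.lsmul ℚ (TSer A) q).toAddMonoidHom)
    fun _ _ hG => by
      rw [zero_add]
      exact bd_smul q hG

theorem Sums.expAd (hφ : φ ∈ bd A w (-1)) {S : ℕ → TSer A} {s : TSer A} (h : Sums w N S s) :
    Sums w N (fun j => expAd D φ (S j)) (expAd D φ s) := fun J => by
  have hS : ∀ i ∈ Finset.range J, S i ∈ bd A w N := fun i _ =>
    bd_mono (by omega) (h.term_mem i)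
  rw [← expAd_sum hφ _ hS, ← expAd_sub hφ h.mem (sum_mem hS)]
  exact bd_expAd hφ (h J)

section Brackets

/-- Write m + 1 = i + (m + 1 − i) and apply Jacobi. The last sum measures how far `a` is from
satisfying the exponential recursion: it is zero for the automorphism property, and a single term
∂φ/∂t for the time derivative. -/
theorem bracket_diagonal {a b : ℕ → TSer A}
    (hb : ∀ j, bracket D φ (b j) = ((j + 1 : ℕ) : ℚ) • b (j + 1)) (m : ℕ) :
    ((m + 1 : ℕ) : ℚ) • ∑ i ∈ Finset.range (m + 1 + 1), bracket D (a i) (b (m + 1 - i)) =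
      bracket D φ (∑ i ∈ Finset.range (m + 1), bracket D (a i) (b (m - i))) +
        ∑ i ∈ Finset.range (m + 1),
          bracket D (((i + 1 : ℕ) : ℚ) • a (i + 1) - bracket D φ (a i)) (b (m - i)) := by
  have hsplit : ((m + 1 : ℕ) : ℚ) • ∑ i ∈ Finset.range (m + 1 + 1),
      bracket D (a i) (b (m + 1 - i)) =
      ∑ i ∈ Finset.range (m + 1 + 1), ((i : ℕ) : ℚ) • bracket D (a i) (b (m + 1 - i)) +
      ∑ i ∈ Finset.range (m + 1 + 1),
        ((m + 1 - i : ℕ) : ℚ) • bracket D (a i) (b (m + 1 - i)) := by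
    rw [Finset.smul_sum, ← Finset.sum_add_distrib]
    refine Finset.sum_congr rfl fun i hi => ?_
    rw [Finset.mem_range] at hi
    rw [← add_smul, ← Nat.cast_add, Nat.add_sub_cancel' (by omega)]
  rw [hsplit, Finset.sum_range_succ', Finset.sum_range_succ _ (m + 1), bracket_sum_right,
    Nat.sub_self, Nat.cast_zero, zero_smul, zero_smul, add_zero, add_zero,
    ← Finset.sum_add_distrib, ← Finset.sum_add_distrib]
  refine Finset.sum_congr rfl fun i hi => ?_
  rw [Finset.mem_range] at hi
  rw [bracket_jacobi, bracket_sub_left, bracket_smul_left, hb, bracket_smul_right,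
    show m + 1 - (i + 1) = m - i by omega, show m + 1 - i = m - i + 1 by omega]
  abel

theorem sums_bracket_diagonal {a b : ℕ → TSer A} {F G : TSer A} (hF : Sums w M a F)
    (hG : Sums w N b G) :
    Sums w (M + N) (fun m => ∑ i ∈ Finset.range (m + 1), bracket D (a i) (b (m - i)))
      (bracket D F G) :=
  Sums.diagonal (S := fun i j => bracket D (a i) (b j)) (r := fun i => bracket D (a i) G)
    (fun i => by
      rw [add_sub_right_comm]
      exact hG.bracket (hF.term_mem i))
    (by
      rw [add_comm]
      exact hF.bracket_left hG.mem)

/-- Since ad φ is a derivation of the bracket, its exponential is an automorphism. Order by order,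
both sides obey the same recursion, which can be solved because m + 1 is invertible in ℚ. -/
theorem expAd_bracket (hφ : φ ∈ bd A w (-1)) {F G : TSer A} (hF : F ∈ bd A w M)
    (hG : G ∈ bd A w N) :
    expAd D φ (bracket D F G) = bracket D (expAd D φ F) (expAd D φ G) := by
  refine (sums_expAd hφ (bd_bracket D hF hG)).unique (?_ : Sums w (M + N) _ _)
  convert sums_bracket_diagonal (D := D) (sums_expAd (D := D) hφ hF) (sums_expAd (D := D) hφ hG)
    using 1
  funext m
  induction m with
  | zero => simp [expTerm_zero]
  | succ m ih =>
    have hm : ((m + 1 : ℕ) : ℚ) ≠ 0 := by positivity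
    have h := bracket_diagonal (D := D) (φ := φ) (a := fun j => expTerm D φ j F)
      (b := fun j => expTerm D φ j G) (expTerm_succ D φ G) m
    simp only [expTerm_succ, sub_self] at h
    rw [← ih, expTerm_succ, Finset.sum_eq_zero (s := Finset.range (m + 1))
      fun i _ => bracket_zero_left D _, add_zero] at h
    exact (smul_right_injective _ hm h).symm

theorem expAd_neg_cancel (hφ : φ ∈ bd A w (-1)) {F : TSer A} (hF : F ∈ bd A w N) :
    expAd D φ (expAd D (-φ) F) = F := by
  have hφ' : -φ ∈ bd A w (-1) := neg_mem hφ
  have h1 := Sums.diagonal (w := w) (N := N)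
    (S := fun i j => expTerm D φ i (expTerm D (-φ) j F))
    (r := fun i => expTerm D φ i (expAd D (-φ) F)) (s := expAd D φ (expAd D (-φ) F))
    (fun i => by
      rw [sub_eq_neg_add]
      exact (sums_expAd (D := D) hφ' hF).map (L := (expTerm D φ i).toAddMonoidHom)
        fun M G hG => bd_mono (by omega) (bd_expTerm (D := D) hφ hG i))
    (sums_expAd hφ (bd_expAd hφ' hF))
  have h2 : ∀ m, ∑ i ∈ Finset.range (m + 1), expTerm D φ i (expTerm D (-φ) (m - i) F) =
      if m = 0 then F else 0 := by
    intro m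
    -- The diagonal sum is (ad φ + ad(−φ))^m / m! by the binomial theorem, hence zero for m > 0.
    have key : ∑ i ∈ Finset.range (m + 1),
        (expTerm D φ i * expTerm D (-φ) (m - i) : Module.End ℚ (TSer A)) =
        (m.factorial : ℚ)⁻¹ • (adLin D φ + adLin D (-φ) : Module.End ℚ (TSer A)) ^ m := by
      have hc : Commute (adLin D φ : Module.End ℚ (TSer A)) (adLin D (-φ)) := by
        rw [adLin_neg]
        exact (Commute.refl (adLin D φ : Module.End ℚ (TSer A))).neg_right
      rw [hc.add_pow, Finset.smul_sum]
      refine Finset.sum_congr rfl fun i hi => ?_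
      rw [Finset.mem_range] at hi
      have hq : (i.factorial : ℚ)⁻¹ * ((m - i).factorial : ℚ)⁻¹ =
          (m.factorial : ℚ)⁻¹ * (m.choose i : ℚ) := by
        rw [Nat.cast_choose ℚ (by omega : i ≤ m)]
        field_simp
      rw [expTerm, expTerm, smul_mul_smul_comm, hq, mul_smul, Nat.cast_smul_eq_nsmul,
        nsmul_eq_mul']
    have := congrArg (fun L : TSer A →ₗ[ℚ] TSer A => L F) key
    simp only [LinearMap.sum_apply] at this
    refine this.trans ?_
    rw [adLin_neg, add_neg_cancel]
    rcases m with - | m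
    · simp
    · simp
  simp only [h2] at h1
  refine h1.unique (?_ : Sums w N _ _)
  rintro (- | J)
  · simpa using hF
  · rw [Finset.sum_range_succ']
    simp

end Brackets

section TimeDerivative

/-- The term `(ad φ) ^ j (∂φ/∂t n) / (j + 1)!` of `∇_{t n, φ} φ`. -/
def nablaTerm (D : Derivation ℚ A A) (φ : TSer A) (n : ℕ+) (j : ℕ) : TSer A :=
  ((j + 1).factorial : ℚ)⁻¹ • (adLin D φ ^ j) (dtDer A n φ)

/-- `∇_{t n, φ} φ`. -/
def nabla (D : Derivation ℚ A A) (φ : TSer A) (n : ℕ+) : TSer A := fsum (nablaTerm D φ n)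

theorem sums_nabla (hφ : φ ∈ bd A 0 (-1)) (n : ℕ+) :
    Sums 0 (-1) (nablaTerm D φ n) (nabla D φ n) :=
  sums_fsum fun j => bd_smul _ (bd_adLin_pow hφ (by simpa using bd_dtDer n hφ) j)

theorem isNabla_nabla (hφ : φ ∈ bd A 0 (-1)) (n : ℕ+) : IsNabla D φ n (nabla D φ n) := by
  have := (sums_nabla (D := D) hφ n).hasFormalSum
  unfold IsNabla
  convert this using 2 with j
  rw [scale_eq_smul, ← adLin_pow_apply]
  rfl

/-- The formula for the derivative of an exponential, and the origin of the factorials (j + 1)! in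
∇φ. -/
theorem dtDer_expAd (hφ : φ ∈ bd A 0 (-1)) {F : TSer A} (hF : F ∈ bd A 0 N) {n : ℕ+}
    (h0 : dtDer A n F = 0) :
    dtDer A n (expAd D φ F) = bracket D (nabla D φ n) (expAd D φ F) := by
  -- Shifted by one place so that `a i` contains i factors φ, counting the differentiated one, which
  -- matches the order of the exponential terms.
  let a : ℕ → TSer A := fun i => Nat.casesOn i 0 (nablaTerm D φ n)
  have ha : Sums 0 0 a (nabla D φ n) := by
    rintro (- | J)
    · simpa using bd_mono (by norm_num) (sums_nabla (D := D) hφ n).mem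
    · rw [Finset.sum_range_succ']
      have h := bd_mono (by push_cast; linarith) (sums_nabla (D := D) hφ n J) (N := 0 - (J + 1 : ℕ))
      have h0 : a 0 = 0 := rfl
      rw [h0, add_zero]
      exact h
  have h1 := (sums_expAd (D := D) hφ hF).dtDer n
  refine h1.unique (?_ : Sums 0 (0 + N) _ _)
  convert sums_bracket_diagonal (D := D) ha (sums_expAd (D := D) hφ hF) using 1
  funext m
  induction m with
  | zero => simp [expTerm_zero, h0, a]
  | succ m ih =>
    have hm : ((m + 1 : ℕ) : ℚ) ≠ 0 := by positivity
    have h := bracket_diagonal (D := D) (φ := φ) (a := a)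
      (b := fun j => expTerm D φ j F) (expTerm_succ D φ F) m
    have hcorr : ∑ i ∈ Finset.range (m + 1), bracket D
        (((i + 1 : ℕ) : ℚ) • a (i + 1) - bracket D φ (a i)) (expTerm D φ (m - i) F) =
        bracket D (dtDer A n φ) (expTerm D φ m F) := by
      -- Only i = 0 violates the exponential recursion, and it contributes ∂φ/∂t n.
      rw [Finset.sum_range_succ', Finset.sum_eq_zero, zero_add]
      · simp [a, nablaTerm]
      · intro i _
        have hi : ((i + 1 + 1 : ℕ) : ℚ) * ((i + 1 + 1).factorial : ℚ)⁻¹ =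
            ((i + 1).factorial : ℚ)⁻¹ := by
          rw [Nat.factorial_succ (i + 1), Nat.cast_mul, mul_inv, mul_inv_cancel_left₀ (by positivity)]
        have : ((i + 1 + 1 : ℕ) : ℚ) • a (i + 1 + 1) - bracket D φ (a (i + 1)) = 0 := by
          change ((i + 1 + 1 : ℕ) : ℚ) • nablaTerm D φ n (i + 1) -
            bracket D φ (nablaTerm D φ n i) = 0
          rw [nablaTerm, nablaTerm, smul_smul, hi, bracket_smul_right, adLin_pow_succ_apply,
            sub_self]
        rw [this, bracket_zero_left]
    rw [hcorr, ← ih, add_comm (bracket _ _ _), ← dtDer_bracket, expTerm_succ, Derivation.map_smul] at h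
    exact (smul_right_injective _ hm h).symm

end TimeDerivative

end TwistorHierarchy

end

noncomputable section

namespace TwistorHierarchy

variable {A : Type*} [CommRing A] [Algebra ℚ A] {D : Derivation ℚ A A}
  {w : (ℕ+ →₀ ℕ) →+ ℤ} {M N : ℤ}

/-! ### Rigidity of the equation {u, X} = c u. -/

section Uniqueness

variable {x : A}

theorem bracket_ofFun_coordinate (hx : D x = 1) (F : TSer A) : bracket D F (ofFun x) = euler F := by
  rw [bracket_ofFun_right, hx, ofFun_one, mul_one]

/-- {u, x} = λ∂u/∂λ, while {u, X − x} has lower degree. Comparing coefficients of λ^d gives (d − c)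
u_d = 0 with d ≠ c. -/
theorem mem_bd_pred_of_bracket_eq (hx : D x = 1) {X u : TSer A} (hX : X - ofFun x ∈ bd A 0 (-1))
    {c d : ℤ} (hcd : d < c) (hu : u ∈ bd A 0 d) (h : bracket D u X = (c : ℚ) • u) :
    u ∈ bd A 0 (d - 1) := by
  have h1 : euler u - (c : ℚ) • u ∈ bd A 0 (d - 1) := by
    have h2 : euler u - (c : ℚ) • u = -bracket D u (X - ofFun x) := by
      rw [bracket_sub_right, bracket_ofFun_coordinate hx, h, neg_sub]
    rw [h2]
    exact neg_mem (bd_bracket D hu hX)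
  rw [mem_bd_zero] at hu h1 ⊢
  intro α k hk
  rcases eq_or_ne k d with rfl | hne
  · have h3 := h1 α k hk
    rw [cf_sub, cf_euler, cf_smul, ← Int.cast_smul_eq_zsmul ℚ, ← sub_smul] at h3
    have h4 : (k : ℚ) - c ≠ 0 := sub_ne_zero.mpr (by exact_mod_cast hcd.ne)
    exact (smul_eq_zero_iff_right h4).mp h3
  · exact hu α k (by omega)

theorem eq_zero_of_bracket_eq (hx : D x = 1) {X u : TSer A} (hX : X - ofFun x ∈ bd A 0 (-1))
    {c d : ℤ} (hcd : d < c) (hu : u ∈ bd A 0 d) (h : bracket D u X = (c : ℚ) • u) : u = 0 := by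
  refine bd_eq_zero (w := 0) d fun J => ?_
  induction J with
  | zero => simpa using hu
  | succ J ih =>
    refine bd_mono ?_ (mem_bd_pred_of_bracket_eq hx hX (by omega) ih h)
    push_cast
    linarith

end Uniqueness

/-! ### Solving e^{ad φ} x = X. -/

section Existence

/-- The inverse of `λ ∂/∂λ` on series without the power `λ ^ 0`. -/
def invEuler (F : TSer A) : TSer A :=
  coeffwise (fun k a => (k : ℚ)⁻¹ • a) (fun _ => smul_zero _) F

theorem cf_invEuler (F : TSer A) (α : ℕ+ →₀ ℕ) (k : ℤ) :
    cf (invEuler F) α k = (k : ℚ)⁻¹ • cf F α k := cf_coeffwise _ _ F α k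

theorem bd_invEuler {F : TSer A} (hF : F ∈ bd A w N) : invEuler F ∈ bd A w N := fun α k hk => by
  rw [cf_invEuler, hF α k hk, smul_zero]

theorem euler_invEuler {F : TSer A} (hF : F ∈ bd A 0 (-1)) : euler (invEuler F) = F :=
  ext_cf fun α k => by
    rw [cf_euler, cf_invEuler, ← Int.cast_smul_eq_zsmul ℚ, smul_smul]
    rcases eq_or_ne k 0 with rfl | hk
    · rw [mem_bd_zero.mp hF α 0 (by norm_num), smul_zero]
    · rw [mul_inv_cancel₀ (by exact_mod_cast hk), one_smul]

variable {x : A}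

theorem adLin_pow_sub_mem {φ ψ : TSer A} (hφ : φ ∈ bd A 0 (-1)) (hψ : ψ ∈ bd A 0 (-1))
    (m : ℕ) (h : φ - ψ ∈ bd A 0 (-1 - m)) {F : TSer A} (hF : F ∈ bd A 0 0) (j : ℕ) :
    (adLin D φ ^ j) F - (adLin D ψ ^ j) F ∈ bd A 0 (-m - j) := by
  induction j with
  | zero => simp
  | succ j ih =>
    have : (adLin D φ ^ (j + 1)) F - (adLin D ψ ^ (j + 1)) F =
        bracket D (φ - ψ) ((adLin D φ ^ j) F) +
          bracket D ψ ((adLin D φ ^ j) F - (adLin D ψ ^ j) F) := by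
      rw [adLin_pow_succ_apply, adLin_pow_succ_apply, bracket_sub_left, bracket_sub_right]
      abel
    rw [this]
    refine add_mem (bd_mono ?_ (bd_bracket D h (bd_adLin_pow hφ hF j)))
      (bd_mono ?_ (bd_bracket D hψ ih)) <;>
    · push_cast
      linarith

/-- Keeps the whole series of differences: the approximation step needs its first-order term, the
limit only its size. -/
theorem sums_expAd_sub {φ ψ : TSer A} (hφ : φ ∈ bd A 0 (-1)) (hψ : ψ ∈ bd A 0 (-1))
    (m : ℕ) (h : φ - ψ ∈ bd A 0 (-1 - m)) {F : TSer A} (hF : F ∈ bd A 0 0) :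
    Sums 0 (-m) (fun j => expTerm D φ j F - expTerm D ψ j F) (expAd D φ F - expAd D ψ F) := by
  have h1 : Sums 0 (-m) _ _ := sums_fsum (S := fun j => expTerm D φ j F - expTerm D ψ j F)
    fun j => by
      rw [expTerm, expTerm, LinearMap.smul_apply, LinearMap.smul_apply, ← smul_sub]
      exact bd_smul _ (adLin_pow_sub_mem hφ hψ m h hF j)
  have h2 : fsum (fun j => expTerm D φ j F - expTerm D ψ j F) + expAd D ψ F = expAd D φ F := by
    refine Sums.unique (w := 0) (N := 0) (w' := 0) (N' := 0) ((h1.mono (by omega)).add (sums_expAd hψ hF)) ?_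
    simpa only [sub_add_cancel] using sums_expAd (D := D) hφ hF
  rwa [← h2, add_sub_cancel_right]

variable (D) in
/-- Successive approximations to a solution `φ` of `e ^ {ad φ} x = X`. -/
def approx (x : A) (X : TSer A) : ℕ → TSer A
  | 0 => 0
  | m + 1 => approx x X m + invEuler (X - expAd D (approx x X m) (ofFun x))

omit [Algebra ℚ A] in
theorem ofFun_mem_bd_zero (a : A) : ofFun a ∈ bd A 0 0 := ofFun_mem_bd (fun _ => le_rfl) a

theorem approx_mem (hx : D x = 1) {X : TSer A} (hX : X - ofFun x ∈ bd A 0 (-1)) (m : ℕ) :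
    approx D x X m ∈ bd A 0 (-1) ∧ X - expAd D (approx D x X m) (ofFun x) ∈ bd A 0 (-1 - m) := by
  induction m with
  | zero =>
    have h0 : (0 : TSer A) ∈ bd A 0 (-1) := zero_mem _
    refine ⟨h0, ?_⟩
    have := sub_mem hX (expAd_sub_self_mem (D := D) h0 (ofFun_mem_bd_zero x))
    simpa [approx] using this
  | succ m ih =>
    obtain ⟨h1, h2⟩ := ih
    have h3 := bd_invEuler h2
    have h4 : approx D x X (m + 1) ∈ bd A 0 (-1) := add_mem h1 (bd_mono (by omega) h3)
    have h5 : approx D x X (m + 1) - approx D x X m =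
        invEuler (X - expAd D (approx D x X m) (ofFun x)) := add_sub_cancel_left _ _
    refine ⟨h4, ?_⟩
    -- To first order e^{ad φ} x changes by {correction, x}, which equals the old residual since the
    -- correction inverts λ∂/∂λ. The remainder after two terms has degree −m − 2, so the residual
    -- gains one order.
    have h6 := sums_expAd_sub (D := D) h4 h1 m (by rwa [h5]) (ofFun_mem_bd_zero x) 2
    simp only [Finset.sum_range_succ, Finset.sum_range_zero, expTerm_zero, expTerm_one, sub_self,
      zero_add] at h6
    rw [← bracket_sub_left, h5, bracket_ofFun_coordinate hx,
      euler_invEuler (bd_mono (by omega) h2)] at h6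
    convert bd_mono (N := -1 - (m + 1 : ℕ)) (by push_cast; linarith) (neg_mem h6) using 1
    abel

/-- Every `X = x + O(λ⁻¹)` is of the form `e ^ {ad φ} x`. -/
theorem exists_expAd_eq (hx : D x = 1) {X : TSer A} (hX : X - ofFun x ∈ bd A 0 (-1)) :
    ∃ φ ∈ bd A 0 (-1), expAd D φ (ofFun x) = X := by
  have hs : Sums 0 (-1) (fun m => approx D x X (m + 1) - approx D x X m) _ := sums_fsum fun m => by
    rw [approx, add_sub_cancel_left]
    exact bd_invEuler (approx_mem hx hX m).2
  refine ⟨_, hs.mem, ?_⟩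
  rw [← sub_eq_zero]
  refine bd_eq_zero (w := 0) 0 fun J => ?_
  have h1 := hs J
  rw [Finset.sum_range_sub, approx, sub_zero] at h1
  have h2 := (sums_expAd_sub (D := D) hs.mem (approx_mem hx hX J).1 J h1
    (ofFun_mem_bd_zero x)).mem
  have h3 := bd_mono (N := -(J : ℤ)) (by omega) (approx_mem hx hX J).2
  rw [zero_sub]
  convert sub_mem h2 h3 using 1
  abel

end Existence

/-! ### Integer powers of Φ. -/

section Powers

variable {Φ : TSer A}

omit [Algebra ℚ A] in
theorem lam_mem_bd_zero (m : ℤ) : lam A m ∈ bd A 0 m := lam_mem_bd (fun _ => le_rfl) m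

omit [Algebra ℚ A] in
theorem lam_one_mul_lam_neg_one : lam A 1 * lam A (-1) = 1 := by
  rw [lam_mul_lam]
  exact lam_zero

omit [Algebra ℚ A] in
theorem HasPhiForm.sub_lam_mem (h : HasPhiForm Φ) : Φ - lam A 1 ∈ bd A 0 0 := mem_bd_zero.mpr h

omit [Algebra ℚ A] in
theorem HasPhiForm.mem (h : HasPhiForm Φ) : Φ ∈ bd A 0 1 := by
  have := add_mem (bd_mono zero_le_one h.sub_lam_mem) (lam_mem_bd_zero 1)
  rwa [sub_add_cancel] at this

omit [Algebra ℚ A] in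
-- Φ = (1 − P)λ with P of degree −1, so the inverse is λ⁻¹ times the geometric series in P.
theorem HasPhiForm.inverse_mem (h : HasPhiForm Φ) : Ring.inverse Φ ∈ bd A 0 (-1) := by
  have hw : ∀ α, 0 ≤ (0 : (ℕ+ →₀ ℕ) →+ ℤ) α := fun _ => le_rfl
  set P : TSer A := 1 - Φ * lam A (-1) with hP
  have hP' : P ∈ bd A 0 (-1) := by
    have : P = -((Φ - lam A 1) * lam A (-1)) := by
      rw [sub_mul, lam_one_mul_lam_neg_one, neg_sub]
    rw [this]
    exact neg_mem (bd_mono (by norm_num) (bd_mul h.sub_lam_mem (lam_mem_bd hw (-1))))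
  have hV : Sums 0 0 (fun j => P ^ j) _ := sums_fsum fun j => by
    simpa using bd_pow hw hP' j
  set V := fsum fun j => P ^ j
  have h1 : Φ * (lam A (-1) * V) = 1 := by
    have : (1 - P) * V - 1 = 0 := by
      refine bd_eq_zero (w := 0) 0 fun J => ?_
      have h2 : (1 - P) * V - 1 = (1 - P) * (V - ∑ j ∈ Finset.range J, P ^ j) - P ^ J := by
        rw [mul_sub, mul_neg_geom_sum]
        ring
      rw [h2]
      have h3 := bd_mul (sub_mem (one_mem_bd hw) (bd_mono (by norm_num) hP')) (hV J)
      have h4 := bd_pow hw hP' J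
      refine sub_mem ?_ ?_
      · simpa using h3
      · simpa using h4
    rw [sub_eq_zero, hP, sub_sub_cancel, mul_assoc] at this
    exact this
  have h2 : Ring.inverse Φ = lam A (-1) * V := by
    rw [← mul_one (Ring.inverse Φ), ← h1, Ring.inverse_mul_cancel_left _ _ h.isUnit]
  rw [h2]
  exact bd_mono (by norm_num) (bd_mul (lam_mem_bd hw (-1)) hV.mem)

omit [Algebra ℚ A] in
theorem HasPhiForm.intPow_mem (h : HasPhiForm Φ) (k : ℤ) : intPow Φ k ∈ bd A 0 k := by
  rcases k with n | n
  · exact bd_mono (mul_one _).le (bd_pow (fun _ => le_rfl) h.mem n)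
  · refine bd_mono ?_ (bd_pow (fun _ => le_rfl) h.inverse_mem (n + 1))
    rw [Int.negSucc_eq]
    push_cast
    linarith

omit [Algebra ℚ A] in
theorem HasPhiForm.intPow_sub_mem (h : HasPhiForm Φ) (k : ℤ) :
    intPow Φ k - lam A k ∈ bd A 0 (k - 1) := by
  have hw : ∀ α, 0 ≤ (0 : (ℕ+ →₀ ℕ) →+ ℤ) α := fun _ => le_rfl
  rcases k with n | n
  · have := bd_pow_sub_pow hw h.mem (lam_mem_bd hw 1) (bd_mono (by norm_num) h.sub_lam_mem) n
    rw [lam_pow, mul_one] at this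
    exact this
  · have h1 : Ring.inverse Φ - lam A (-1) ∈ bd A 0 (-1 - 1) := by
      have h2 : Ring.inverse Φ - lam A (-1) =
          -(Ring.inverse Φ * (Φ - lam A 1) * lam A (-1)) := by
        rw [mul_sub, Ring.inverse_mul_cancel _ h.isUnit, sub_mul, mul_assoc,
          lam_one_mul_lam_neg_one, mul_one, one_mul, neg_sub]
      rw [h2]
      exact neg_mem (bd_mono (by norm_num) (bd_mul (bd_mul h.inverse_mem h.sub_lam_mem)
        (lam_mem_bd hw (-1))))
    have := bd_pow_sub_pow hw h.inverse_mem (lam_mem_bd hw (-1)) h1 (n + 1)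
    rw [lam_pow] at this
    have h3 : ((n + 1 : ℕ) : ℤ) * -1 = Int.negSucc n := by
      rw [Int.negSucc_eq]
      push_cast
      ring
    rwa [h3] at this

theorem derivation_intPow (δ : Derivation ℚ (TSer A) (TSer A)) (hΦ : IsUnit Φ) {c : ℚ}
    (h : δ Φ = c • Φ) (k : ℤ) : δ (intPow Φ k) = ((k : ℚ) * c) • intPow Φ k := by
  have hpow : ∀ (G : TSer A) (c : ℚ), δ G = c • G → ∀ n : ℕ, δ (G ^ n) = ((n : ℚ) * c) • G ^ n := by
    intro G c hG n
    induction n with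
    | zero => simp
    | succ n ih =>
      rw [pow_succ, Derivation.leibniz, ih, hG, smul_eq_mul, smul_eq_mul, mul_smul_comm,
        mul_smul_comm, mul_comm G, ← add_smul]
      congr 1
      push_cast
      ring
  rcases k with n | n
  · exact hpow Φ c h n
  · have h1 : δ (Ring.inverse Φ) = (-c) • Ring.inverse Φ := by
      rw [δ.leibniz_of_mul_eq_one (Ring.inverse_mul_cancel _ hΦ), h, smul_eq_mul, mul_smul_comm,
        sq, neg_mul, mul_assoc, Ring.inverse_mul_cancel _ hΦ, mul_one, smul_neg, neg_smul]
    refine (hpow _ _ h1 (n + 1)).trans ?_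
    rw [Int.cast_negSucc]
    change _ = _ • Ring.inverse Φ ^ (n + 1)
    congr 1
    push_cast
    ring

end Powers

/-! ### Taylor expansion, and e^{ad φ} as a substitution. -/

section Taylor

/-- The term `(∂ₓ^j a) (x) * Y ^ j / j!` of the Taylor expansion of `a (x + Y)`. -/
def taylorTerm (D : Derivation ℚ A A) (Y : TSer A) (a : A) (j : ℕ) : TSer A :=
  (j.factorial : ℚ)⁻¹ • (ofFun (D^[j] a) * Y ^ j)

/-- The Taylor expansion of `a (x + Y)`. -/
def taylor (D : Derivation ℚ A A) (Y : TSer A) (a : A) : TSer A := fsum (taylorTerm D Y a)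

variable {Y : TSer A}

theorem bd_taylorTerm (hw : ∀ α, 0 ≤ w α) (hY : Y ∈ bd A w (-1)) (a : A) (j : ℕ) :
    taylorTerm D Y a j ∈ bd A w (0 - j) :=
  bd_smul _ (bd_mono (by simp) (bd_mul (ofFun_mem_bd hw _) (bd_pow hw hY j)))

theorem sums_taylor (hw : ∀ α, 0 ≤ w α) (hY : Y ∈ bd A w (-1)) (a : A) :
    Sums w 0 (taylorTerm D Y a) (taylor D Y a) := sums_fsum (bd_taylorTerm hw hY a)

theorem taylor_sub_mem (hw : ∀ α, 0 ≤ w α) (hY : Y ∈ bd A w (-1)) (a : A) :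
    taylor D Y a - ofFun a ∈ bd A w (-1) := by
  simpa [taylorTerm] using sums_taylor (D := D) hw hY a 1

/-- A continuous derivation that kills `x + Y` kills the Taylor expansion of `a (x + Y)`. -/
theorem derivation_taylor (hw : ∀ α, 0 ≤ w α) (hY : Y ∈ bd A w (-1))
    (δ : Derivation ℚ (TSer A) (TSer A)) {c : ℤ}
    (hδ : ∀ N F, F ∈ bd A w N → δ F ∈ bd A w (c + N)) {h : TSer A} (hh : h ∈ bd A w c)
    (hfun : ∀ a : A, δ (ofFun a) = ofFun (D a) * h) (hδY : δ Y = -h) (a : A) :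
    δ (taylor D Y a) = 0 := by
  -- The sum telescopes: differentiating Y^{j+1} cancels the derivative of the preceding
  -- coefficient, and one term of degree c − J survives.
  have key : ∀ J : ℕ, δ (∑ j ∈ Finset.range (J + 1), taylorTerm D Y a j) =
      (J.factorial : ℚ)⁻¹ • (ofFun (D^[J + 1] a) * h * Y ^ J) := by
    intro J
    induction J with
    | zero => simp [taylorTerm, hfun]
    | succ J ih =>
      rw [Finset.sum_range_succ, map_add, ih, taylorTerm, Derivation.map_smul, Derivation.leibniz,
        Derivation.leibniz_pow, hfun, hδY, ← Function.iterate_succ_apply' D]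
      have hJ : (J.factorial : ℚ)⁻¹ = ((J + 1).factorial : ℚ)⁻¹ * ((J + 1 : ℕ) : ℚ) := by
        rw [Nat.factorial_succ]
        push_cast
        field_simp
      rw [hJ, mul_smul, ← smul_add]
      congr 1
      simp only [smul_eq_mul, Nat.add_sub_cancel, ← Nat.cast_smul_eq_nsmul ℚ, mul_neg, smul_neg,
        mul_smul_comm]
      rw [show Y ^ (J + 1) * (ofFun (D^[(J + 1).succ] a) * h) =
        ofFun (D^[J + 1 + 1] a) * h * Y ^ (J + 1) by rw [Nat.succ_eq_add_one]; ring,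
        show ofFun (D^[J + 1] a) * (Y ^ J * h) = ofFun (D^[J + 1] a) * h * Y ^ J by ring]
      abel
  refine bd_eq_zero (w := w) c fun J => ?_
  have h1 := hδ _ _ (sums_taylor (D := D) hw hY a (J + 1))
  rw [map_sub, key] at h1
  have h2 : (J.factorial : ℚ)⁻¹ • (ofFun (D^[J + 1] a) * h * Y ^ J) ∈ bd A w (c - J) :=
    bd_smul _ (bd_mono (by linarith) (bd_mul (bd_mul (ofFun_mem_bd hw _) hh) (bd_pow hw hY J)))
  have h3 := add_mem (bd_mono (N := c - J) (by push_cast; linarith) h1) h2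
  rwa [sub_add_cancel] at h3

variable {x : A} {φ : TSer A}

theorem hasPhiForm_expAd (hφ : φ ∈ bd A 0 (-1)) : HasPhiForm (expAd D φ (lam A 1)) :=
  mem_bd_zero.mp (expAd_sub_self_mem hφ (lam_mem_bd_zero 1))

theorem expAd_ofFun_sub_mem (hφ : φ ∈ bd A 0 (-1)) (a : A) :
    expAd D φ (ofFun a) - ofFun a ∈ bd A 0 (-1) :=
  expAd_sub_self_mem hφ (ofFun_mem_bd_zero a)

theorem euler_ofFun_mul_lam (a : A) (k : ℤ) :
    euler (ofFun a * lam A k) = (k : ℚ) • (ofFun a * lam A k) := by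
  rw [euler_mul, euler_ofFun, mul_zero, add_zero, euler_lam, mul_smul_comm]

/-- `e ^ {ad φ}` is the substitution of `e ^ {ad φ} λ` and `e ^ {ad φ} x` for `λ` and `x`. -/
theorem expAd_ofFun_mul_lam (hx : D x = 1) (hφ : φ ∈ bd A 0 (-1)) (a : A) (k : ℤ) :
    expAd D φ (ofFun a * lam A k) =
      taylor D (expAd D φ (ofFun x) - ofFun x) a * intPow (expAd D φ (lam A 1)) k := by
  have hw : ∀ α, 0 ≤ (0 : (ℕ+ →₀ ℕ) →+ ℤ) α := fun _ => le_rfl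
  have hX := expAd_ofFun_sub_mem (D := D) hφ x
  have hm : ofFun a * lam A k ∈ bd A 0 k := by
    simpa using bd_mul (ofFun_mem_bd_zero a) (lam_mem_bd_zero k)
  have hΦ := hasPhiForm_expAd (D := D) hφ
  have hXmem := bd_expAd (D := D) hφ (ofFun_mem_bd_zero x)
  set X := expAd D φ (ofFun x) with hXdef
  set Φ := expAd D φ (lam A 1) with hΦdef
  -- δ F = {F, X} kills X, hence every Taylor expansion at X, and satisfies δΦ = Φ.
  set δ := -adDer D X with hδdef
  have hδ : ∀ F, δ F = bracket D F X := fun F => (bracket_skew D F X).symm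
  have hδΦ : δ Φ = (1 : ℚ) • Φ := by
    rw [hδ, hXdef, hΦdef, ← expAd_bracket hφ (lam_mem_bd_zero 1) (ofFun_mem_bd_zero x),
      bracket_ofFun_coordinate hx, euler_lam, Int.cast_one, one_smul, one_smul]
  have hfun : ∀ a : A, δ (ofFun a) = ofFun (D a) * -euler X := by
    intro a
    rw [hδ, bracket, euler_ofFun, dx_ofFun]
    ring
  have hXX : bracket D X X = 0 := by
    rw [bracket]
    ring
  have hT : δ (taylor D (X - ofFun x) a) = 0 := by
    refine derivation_taylor hw hX δ (c := 0) (fun N F hF => ?_) (neg_mem (bd_euler hXmem)) hfun ?_ a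
    · rw [hδ, add_comm]
      exact bd_bracket D hF hXmem
    · rw [map_sub, hfun, hx, ofFun_one, one_mul, hδ, hXX, zero_sub]
  rw [← sub_eq_zero]
  -- Both sides have leading term a λ^k and satisfy {u, X} = k u, so rigidity applies to their
  -- difference.
  refine eq_zero_of_bracket_eq hx hX (c := k) (d := k - 1) (by omega) ?_ ?_
  · have h1 := expAd_sub_self_mem (D := D) hφ hm
    have h2 := bd_mul (taylor_sub_mem (D := D) hw hX a) (hΦ.intPow_mem k)
    have h3 := bd_mul (ofFun_mem_bd_zero a) (hΦ.intPow_sub_mem k)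
    convert sub_mem (sub_mem h1 (bd_mono (by omega) h2)) (bd_mono (by omega) h3) using 1
    ring
  · rw [bracket_sub_left, ← hδ (_ * _), Derivation.leibniz, hT, derivation_intPow δ hΦ.isUnit hδΦ,
      smul_zero, add_zero, smul_eq_mul, mul_smul_comm, hXdef,
      ← expAd_bracket hφ hm (ofFun_mem_bd_zero x), bracket_ofFun_coordinate hx,
      euler_ofFun_mul_lam, expAd_smul hφ hm, mul_one, smul_sub]

end Taylor

end TwistorHierarchy

end

/-! ### The weight of the times and the time-dependent part of Ψ. -/

noncomputable section

namespace TwistorHierarchy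

variable {A : Type*} [CommRing A]

section Weight

/-- The weight `∑ n, 2 n α n` of the monomial `t ^ α`. -/
def timeWeight : (ℕ+ →₀ ℕ) →+ ℤ :=
  Finsupp.liftAddHom fun n : ℕ+ =>
    (AddMonoidHom.mulLeft (2 * (n : ℤ))).comp (Nat.castAddMonoidHom ℤ)

theorem timeWeight_single (n : ℕ+) : timeWeight (Finsupp.single n 1) = 2 * (n : ℤ) := by
  simp [timeWeight]

theorem timeWeight_nonneg (α : ℕ+ →₀ ℕ) : 0 ≤ timeWeight α := by
  rw [timeWeight, Finsupp.liftAddHom_apply]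
  exact Finset.sum_nonneg fun n _ => by simp

theorem cf_X (n : ℕ+) (α : ℕ+ →₀ ℕ) (k : ℤ) :
    cf (MvPowerSeries.X n : TSer A) α k = if α = Finsupp.single n 1 ∧ k = 0 then 1 else 0 := by
  classical
  rw [cf, MvPowerSeries.coeff_X]
  by_cases hα : α = Finsupp.single n 1 <;> by_cases hk : k = 0 <;> simp [hα, hk, HahnSeries.coeff_one]

theorem X_mem_bd (n : ℕ+) : (MvPowerSeries.X n : TSer A) ∈ bd A timeWeight (-(2 * (n : ℤ))) := by
  intro α k hk
  rw [cf_X, if_neg]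
  rintro ⟨rfl, rfl⟩
  rw [timeWeight_single] at hk
  omega

end Weight

theorem HasFormalSum.reindex {ι κ : Type*} (e : ι ≃ κ) {S : κ → TSer A} {s : TSer A}
    (h : HasFormalSum (fun i => S (e i)) s) : HasFormalSum S s := by
  intro α k
  obtain ⟨h1, h2⟩ := h α k
  refine ⟨?_, by rw [h2, ← finsum_comp_equiv e]⟩
  refine (h1.image e).subset fun i hi => ⟨e.symm i, ?_, e.apply_symm_apply i⟩
  simpa using hi

variable [Algebra ℚ A] {D : Derivation ℚ A A} {ε : ℕ+ → ℤˣ} {Φ Ψ : TSer A} {x : A}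

theorem timeTerm_eq (ε : ℕ+ → ℤˣ) (Φ : TSer A) (n : ℕ+) :
    timeTerm ε Φ n = (((ε n : ℤ) : ℚ) / (n : ℕ)) • ((MvPowerSeries.X n : TSer A) * Φ ^ (n : ℕ)) :=
  scale_eq_smul _ _

/-- This is where weight 2n for tₙ matters: it makes the degree tend to −∞ with n, so that the sum
converges, and negative, so that Taylor expansions in Ψ − x converge. Weight n would only give
degree 0. -/
theorem bd_timeTerm (hΦ : Φ ∈ bd A 0 1) (n : ℕ+) :
    timeTerm ε Φ n ∈ bd A timeWeight (-(n : ℤ)) := by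
  rw [timeTerm_eq]
  refine bd_smul _ (bd_mono ?_ (bd_mul (X_mem_bd n)
    (bd_pow timeWeight_nonneg (bd_weight_mono timeWeight_nonneg hΦ) n)))
  have : (((n : ℕ) : ℤ)) = (n : ℤ) := rfl
  omega

/-- The series `∑_{n ≥ 1} ε n * t n / n * Φ ^ n`. -/
def timeSum (ε : ℕ+ → ℤˣ) (Φ : TSer A) : TSer A := fsum fun j => timeTerm ε Φ j.succPNat

theorem sums_timeSum (hΦ : Φ ∈ bd A 0 1) :
    Sums timeWeight (-1) (fun j => timeTerm ε Φ j.succPNat) (timeSum ε Φ) :=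
  sums_fsum fun j => bd_mono (by simp) (bd_timeTerm hΦ j.succPNat)

theorem hasFormalSum_timeSum (hΦ : Φ ∈ bd A 0 1) :
    HasFormalSum (timeTerm ε Φ) (timeSum ε Φ) :=
  HasFormalSum.reindex Equiv.pnatEquivNat.symm (sums_timeSum hΦ).hasFormalSum

theorem timeSum_lam : timeSum ε (lam A 1) = timeSeries A ε :=
  (hasFormalSum_timeSum (lam_mem_bd_zero 1)).unique (hasFormalSum_timeSeries ε)

omit [Algebra ℚ A] in
theorem euler_X (n : ℕ+) : euler (MvPowerSeries.X n : TSer A) = 0 := ext_cf fun α k => by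
  rw [cf_euler, cf_X, cf_zero]
  split_ifs with h
  · rw [h.2, zero_smul]
  · rw [smul_zero]

theorem dx_X (n : ℕ+) : dx D (MvPowerSeries.X n : TSer A) = 0 := ext_cf fun α k => by
  rw [cf_dx, cf_X, cf_zero]
  split_ifs <;> simp

theorem bracket_X (F : TSer A) (n : ℕ+) : bracket D F (MvPowerSeries.X n) = 0 := by
  rw [bracket, euler_X, dx_X, mul_zero, mul_zero, sub_zero]

theorem dtDer_X (m n : ℕ+) :
    dtDer A m (MvPowerSeries.X n) = if n = m then 1 else 0 := by
  classical
  rw [dtDer_apply, MvPowerSeries.pderiv_X, Pi.single_apply]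

/-- A continuous derivation that kills `Φ` acts on `∑ n, ε n * t n / n * Φ ^ n` through its
values at the times. -/
theorem derivation_timeSum (hΦ : Φ ∈ bd A 0 1) (δ : Derivation ℚ (TSer A) (TSer A)) {c : ℤ}
    (hδ : ∀ N F, F ∈ bd A timeWeight N → δ F ∈ bd A timeWeight (c + N)) (hδΦ : δ Φ = 0) (m : ℕ+)
    (hX : ∀ n, δ (MvPowerSeries.X n) = if n = m then 1 else 0) :
    δ (timeSum ε Φ) = (((ε m : ℤ) : ℚ) / (m : ℕ)) • Φ ^ (m : ℕ) := by
  have h1 : Sums timeWeight (c + -1) _ _ :=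
    (sums_timeSum (ε := ε) hΦ).map (L := δ.toLinearMap.toAddMonoidHom) hδ
  refine h1.hasFormalSum.unique fun α k => ?_
  have h2 : ∀ n, δ (timeTerm ε Φ n) =
      if n = m then (((ε m : ℤ) : ℚ) / (m : ℕ)) • Φ ^ (m : ℕ) else 0 := by
    intro n
    rw [timeTerm_eq, Derivation.map_smul, Derivation.leibniz, Derivation.leibniz_pow, hδΦ, hX]
    split_ifs with h
    · rw [h]
      simp
    · simp
  have h3 : ∀ j : ℕ, δ.toLinearMap.toAddMonoidHom (timeTerm ε Φ j.succPNat) =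
      if j = m.natPred then (((ε m : ℤ) : ℚ) / (m : ℕ)) • Φ ^ (m : ℕ) else 0 := by
    intro j
    refine (h2 _).trans ?_
    congr 1
    rw [eq_iff_iff]
    constructor
    · rintro rfl
      exact (Nat.natPred_succPNat j).symm
    · rintro rfl
      exact PNat.succPNat_natPred m
  simp only [h3]
  have hsub : (Function.support fun j : ℕ => cf (if j = m.natPred then
      (((ε m : ℤ) : ℚ) / (m : ℕ)) • Φ ^ (m : ℕ) else 0) α k) ⊆ ({m.natPred} : Finset ℕ) := by
    intro j hj
    rw [Finset.coe_singleton, Set.mem_singleton_iff]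
    by_contra hne
    simp [hne] at hj
  refine ⟨(Finset.finite_toSet _).subset hsub, ?_⟩
  rw [finsum_eq_sum_of_support_subset _ hsub, Finset.sum_singleton, if_pos rfl]

theorem derivation_timeSum_eq_zero (hΦ : Φ ∈ bd A 0 1) (δ : Derivation ℚ (TSer A) (TSer A)) {c : ℤ}
    (hδ : ∀ N F, F ∈ bd A timeWeight N → δ F ∈ bd A timeWeight (c + N)) (hδΦ : δ Φ = 0)
    (hX : ∀ n, δ (MvPowerSeries.X n) = 0) : δ (timeSum ε Φ) = 0 := by
  have h1 : Sums timeWeight (c + -1) _ _ :=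
    (sums_timeSum (ε := ε) hΦ).map (L := δ.toLinearMap.toAddMonoidHom) hδ
  refine h1.eq_zero_of_forall fun j => ?_
  change δ (timeTerm ε Φ _) = 0
  rw [timeTerm_eq, Derivation.map_smul, Derivation.leibniz, Derivation.leibniz_pow, hδΦ, hX]
  simp

/-- The terms v_i Φ^{-i} contain only negative powers of λ, so at nonnegative powers Ψ − x agrees
with the time sum. -/
theorem psi_sub_timeSum_mem (hΦ : HasPhiForm Φ) (hΨ : HasPsiForm x ε Φ Ψ) :
    Ψ - timeSum ε Φ - ofFun x ∈ bd A 0 (-1) := by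
  obtain ⟨v, hv⟩ := hΨ
  rw [mem_bd_zero]
  intro α k hk
  rw [sub_right_comm, cf_sub, sub_eq_zero, (hv α k).2, (hasFormalSum_timeSum hΦ.mem α k).2]
  have hzero : ∀ i : ℕ+, cf (ofTime (v i) * intPow Φ (-(i : ℤ))) α k = 0 := by
    intro i
    rw [cf, MvPowerSeries.coeff_mul, HahnSeries.coeff_sum]
    refine Finset.sum_eq_zero fun p _ => ?_
    rw [ofTime, MvPowerSeries.coeff_map, HahnSeries.C_apply, HahnSeries.coeff_single_zero_mul]
    have h1 := mem_bd_zero.mp (hΦ.intPow_mem (-(i : ℤ))) p.2 k (by have := i.pos; omega)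
    rw [cf] at h1
    rw [h1, mul_zero]
  refine Eq.trans ?_ (finsum_mem_range Sum.inl_injective (f := fun s => cf (Sum.elim (timeTerm ε Φ)
    (fun i : ℕ+ => ofTime (v i) * intPow Φ (-(i : ℤ))) s) α k))
  refine finsum_congr fun s => ?_
  rcases s with n | i
  · simp
  · simp [hzero i]

/-! ### Construction of the dressing function. -/

section Dressing

variable {φ : TSer A}

theorem taylor_one {Y : TSer A} (hY : Y ∈ bd A 0 (-1)) : taylor D Y 1 = 1 := by
  refine (sums_taylor (fun _ => le_rfl) hY 1).unique (w' := 0) (N' := 0) ?_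
  have hD : ∀ j : ℕ, D^[j + 1] 1 = 0 := by
    intro j
    rw [Function.iterate_succ_apply, Derivation.map_one_eq_zero, Function.iterate_fixed (map_zero D)]
  have h0 : ofFun (0 : A) = 0 := by simp [ofFun, const]
  rintro (- | J)
  · simpa using one_mem_bd (A := A) (w := 0) fun _ => le_rfl
  · rw [Finset.sum_range_succ', Finset.sum_eq_zero]
    · simp [taylorTerm, ofFun_one]
    · intro j _
      rw [taylorTerm, hD, h0, zero_mul, smul_zero]

theorem expAd_lam (hx : D x = 1) (hφ : φ ∈ bd A 0 (-1)) (k : ℤ) :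
    expAd D φ (lam A k) = intPow (expAd D φ (lam A 1)) k := by
  have := expAd_ofFun_mul_lam hx hφ 1 k
  rwa [ofFun_one, one_mul, taylor_one (expAd_ofFun_sub_mem hφ x), one_mul] at this

theorem expAd_X_mul {w : (ℕ+ →₀ ℕ) →+ ℤ} {N M : ℤ} (hφ : φ ∈ bd A w (-1)) {F : TSer A}
    (hF : F ∈ bd A w N) (n : ℕ+) (hn : (MvPowerSeries.X n : TSer A) ∈ bd A w M) :
    expAd D φ (MvPowerSeries.X n * F) = MvPowerSeries.X n * expAd D φ F := by
  refine (sums_expAd hφ (bd_mul hn hF)).unique (?_ : Sums w (M + N) _ _)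
  convert (sums_expAd (D := D) hφ hF).mul_left hn using 1
  funext j
  have : (adLin D φ ^ j) (MvPowerSeries.X n * F) = MvPowerSeries.X n * (adLin D φ ^ j) F := by
    induction j with
    | zero => simp
    | succ j ih =>
      rw [adLin_pow_succ_apply, adLin_pow_succ_apply, ih, bracket_mul_right, bracket_X, mul_zero,
        add_zero]
  rw [expTerm, LinearMap.smul_apply, LinearMap.smul_apply, this, mul_smul_comm]

theorem expAd_timeSeries (hx : D x = 1) (hφ : φ ∈ bd A 0 (-1)) :
    expAd D φ (timeSeries A ε) = timeSum ε (expAd D φ (lam A 1)) := by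
  have hφ' := bd_weight_mono timeWeight_nonneg hφ
  rw [← timeSum_lam]
  refine ((sums_timeSum (lam_mem_bd_zero 1)).expAd hφ').unique
    (?_ : Sums timeWeight (-1) _ _)
  convert sums_timeSum (ε := ε) (bd_expAd (D := D) hφ (lam_mem_bd_zero 1)) using 1
  funext j
  have hl : ∀ m : ℤ, lam A m ∈ bd A timeWeight m := lam_mem_bd timeWeight_nonneg
  rw [timeTerm_eq, timeTerm_eq, lam_pow, mul_one, expAd_smul hφ' (bd_mul (X_mem_bd _) (hl _)),
    expAd_X_mul hφ' (hl _) _ (X_mem_bd _), expAd_lam hx hφ]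
  rfl

theorem bareSeries_mem : bareSeries x ε ∈ bd A timeWeight 0 := by
  rw [bareSeries, ← timeSum_lam]
  exact add_mem (ofFun_mem_bd timeWeight_nonneg x)
    (bd_mono (by norm_num) (sums_timeSum (lam_mem_bd_zero 1)).mem)

theorem expAd_bareSeries (hx : D x = 1) (hφ : φ ∈ bd A 0 (-1)) :
    expAd D φ (bareSeries x ε) = expAd D φ (ofFun x) + timeSum ε (expAd D φ (lam A 1)) := by
  have hφ' := bd_weight_mono timeWeight_nonneg hφ
  rw [bareSeries, expAd_add (N := 0) hφ' (ofFun_mem_bd timeWeight_nonneg x), expAd_timeSeries hx hφ]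
  rw [← timeSum_lam]
  exact bd_mono (by norm_num) (sums_timeSum (lam_mem_bd_zero 1)).mem

theorem hamiltonian_eq (n : ℕ+) : hamiltonian ε Φ n =
    (((ε n : ℤ) : ℚ) / (n : ℕ) ^ 2) • nonnegPart (Φ ^ (n : ℕ)) := scale_eq_smul _ _

theorem bd_hamiltonian (hΦ : Φ ∈ bd A 0 1) (n : ℕ+) : hamiltonian ε Φ n ∈ bd A 0 n := by
  rw [hamiltonian_eq]
  refine bd_smul _ (mem_bd_zero.mpr fun α k hk => ?_)
  have h := mem_bd_zero.mp (bd_pow (fun _ => le_rfl) hΦ n) α k (by rw [mul_one]; exact hk)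
  rw [cf_nonnegPart, h, ite_self]

/-- The derivation `∂/∂t n - ad (H n)`. -/
def laxDer (D : Derivation ℚ A A) (ε : ℕ+ → ℤˣ) (Φ : TSer A) (n : ℕ+) :
    Derivation ℚ (TSer A) (TSer A) := dtDer A n - adDer D (hamiltonian ε Φ n)

theorem laxDer_apply (n : ℕ+) (F : TSer A) :
    laxDer D ε Φ n F = dtDer A n F - bracket D (hamiltonian ε Φ n) F := rfl

theorem bd_laxDer (hΦ : Φ ∈ bd A 0 1) (n : ℕ+) (N : ℤ) (F : TSer A) (hF : F ∈ bd A timeWeight N) :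
    laxDer D ε Φ n F ∈ bd A timeWeight (2 * n + N) := by
  have h1 := bd_dtDer n hF
  rw [timeWeight_single] at h1
  have h2 := bd_bracket D (bd_weight_mono timeWeight_nonneg (bd_hamiltonian (ε := ε) hΦ n)) hF
  exact sub_mem h1 (bd_mono (by have := n.pos; omega) h2)

theorem IsSolution.laxDer_phi (h : IsSolution D x ε Φ Ψ) (n : ℕ+) : laxDer D ε Φ n Φ = 0 :=
  sub_eq_zero.mpr (h.lax_phi n)

theorem IsSolution.laxDer_psi (h : IsSolution D x ε Φ Ψ) (n : ℕ+) : laxDer D ε Φ n Ψ = 0 :=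
  sub_eq_zero.mpr (h.lax_psi n)

theorem IsSolution.laxDer_timeSum (h : IsSolution D x ε Φ Ψ) (n : ℕ+) :
    laxDer D ε Φ n (timeSum ε Φ) = (((ε n : ℤ) : ℚ) / (n : ℕ)) • Φ ^ (n : ℕ) :=
  derivation_timeSum h.phi_form.mem _ (bd_laxDer h.phi_form.mem n) (h.laxDer_phi n) n fun m => by
    rw [laxDer_apply, bracket_X, sub_zero, dtDer_X]

theorem bracket_self (F : TSer A) : bracket D F F = 0 := by
  rw [bracket]
  ring

/-- The times have zero bracket with everything and {Φ, Φ} = 0, so the time terms do not affect the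
canonical relation. -/
theorem IsSolution.bracket_phi (h : IsSolution D x ε Φ Ψ) :
    bracket D Φ (Ψ - timeSum ε Φ) = Φ := by
  have h1 := derivation_timeSum_eq_zero (ε := ε) h.phi_form.mem (adDer D Φ) (c := 1)
    (fun N F hF => bd_bracket D (bd_weight_mono timeWeight_nonneg h.phi_form.mem) hF)
    (bracket_self Φ) (bracket_X Φ)
  rw [adDer_apply] at h1
  rw [bracket_sub_right, h.canonical, h1, sub_zero]

theorem IsSolution.bracket_phi_pow (h : IsSolution D x ε Φ Ψ) (n : ℕ) :
    bracket D (Φ ^ n) (Ψ - timeSum ε Φ) = (n : ℚ) • Φ ^ n := by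
  have h1 : (-adDer D (Ψ - timeSum ε Φ)) Φ = (1 : ℚ) • Φ := by
    rw [one_smul]
    exact (bracket_skew D _ _).symm.trans h.bracket_phi
  have := derivation_intPow _ h.phi_form.isUnit h1 n
  rw [mul_one] at this
  exact (bracket_skew D _ _).trans this

theorem IsSolution.exists_isDressing (hx : D x = 1) (h : IsSolution D x ε Φ Ψ) :
    ∃ φ, IsDressing D x ε φ Φ Ψ := by
  have hX := psi_sub_timeSum_mem h.phi_form h.psi_form
  obtain ⟨φ, hφ, hφX⟩ := exists_expAd_eq hx hX
  have hΦ : expAd D φ (lam A 1) = Φ := by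
    rw [← sub_eq_zero]
    -- Both series are λ + O(1) and satisfy {u, X} = u for X = Ψ − `timeSum ε Φ`.
    refine eq_zero_of_bracket_eq hx hX (c := 1) (d := 0) (by norm_num) ?_ ?_
    · rw [← sub_sub_sub_cancel_right _ _ (lam A 1)]
      exact sub_mem (mem_bd_zero.mpr (hasPhiForm_expAd hφ)) h.phi_form.sub_lam_mem
    · rw [bracket_sub_left, h.bracket_phi, ← hφX,
        ← expAd_bracket hφ (lam_mem_bd_zero 1) (ofFun_mem_bd_zero x),
        bracket_ofFun_coordinate hx, euler_lam, Int.cast_one, one_smul, one_smul]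
  refine ⟨φ, fun α k hk => mem_bd_zero.mp hφ α k (by omega), ?_, ?_, fun n => ?_⟩
  · have := isExpAd_expAd (D := D) hφ (lam_mem_bd_zero 1)
    rwa [hΦ] at this
  · have := isExpAd_expAd (D := D) (bd_weight_mono timeWeight_nonneg hφ)
      (bareSeries_mem (x := x) (ε := ε))
    rwa [expAd_bareSeries hx hφ, hφX, hΦ, sub_add_cancel] at this
  · have hE : expAd D φ (lam A n) = Φ ^ (n : ℕ) := by
      rw [expAd_lam hx hφ, hΦ]
      rfl
    refine ⟨Φ ^ (n : ℕ), ?_, ?_⟩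
    · have := isExpAd_expAd (D := D) hφ (lam_mem_bd_zero n)
      rwa [hE] at this
    · have hnabla : nabla D φ n =
          -scale (((ε n : ℤ) : ℚ) / (n : ℕ) ^ 2) (negPart (Φ ^ (n : ℕ))) := by
        rw [scale_eq_smul, ← sub_eq_zero, sub_neg_eq_add]
        refine eq_zero_of_bracket_eq hx hX (c := 0) (d := -1) (by norm_num) ?_ ?_
        · refine add_mem (sums_nabla hφ n).mem (bd_smul _ (mem_bd_zero.mpr fun α k hk => ?_))
          rw [cf_negPart, if_neg (by omega)]
        · have h1 := dtDer_expAd (D := D) hφ (ofFun_mem_bd_zero x) (dtDer_ofFun n x)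
          rw [hφX] at h1
          have h2 : dtDer A n (Ψ - timeSum ε Φ) =
              bracket D (hamiltonian ε Φ n) (Ψ - timeSum ε Φ) -
                (((ε n : ℤ) : ℚ) / (n : ℕ)) • Φ ^ (n : ℕ) := by
            have h3 : laxDer D ε Φ n (Ψ - timeSum ε Φ) = _ := map_sub _ _ _
            rw [h.laxDer_psi, h.laxDer_timeSum, laxDer_apply, zero_sub, sub_eq_iff_eq_add'] at h3
            exact h3.trans (sub_eq_add_neg _ _).symm
          have hn : ((n : ℕ) : ℚ) ≠ 0 := by exact_mod_cast n.pos.ne'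
          -- The two projections recombine to Φⁿ, and {Φⁿ, X} = nΦⁿ cancels the inhomogeneous term
          -- of the Lax equation for X, since (ε/n²) n = ε/n.
          rw [Int.cast_zero, zero_smul, bracket_add_left, ← h1, h2, hamiltonian_eq,
            sub_add_eq_add_sub, ← bracket_add_left, ← smul_add,
            add_comm (nonnegPart _), negPart_add_nonnegPart, bracket_smul_left, h.bracket_phi_pow,
            smul_smul, ← sub_smul]
          convert zero_smul ℚ (Φ ^ (n : ℕ)) using 2
          field_simp
          ring
      rw [← hnabla]
      exact isNabla_nabla hφ n

end Dressing

end TwistorHierarchy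

end

/-! ### Restriction to t = 0. -/

noncomputable section

namespace TwistorHierarchy

variable {A : Type*} [CommRing A]

section RestrictionToZero

/-- The value at `t = 0`, as a series that does not depend on the times. -/
def restrictZero (A : Type*) [CommRing A] : TSer A →+* TSer A :=
  (MvPowerSeries.C).comp MvPowerSeries.constantCoeff

theorem restrictZero_apply (F : TSer A) : restrictZero A F = const (atZero F) := rfl

theorem cf_restrictZero (F : TSer A) (α : ℕ+ →₀ ℕ) (k : ℤ) :
    cf (restrictZero A F) α k = if α = 0 then cf F 0 k else 0 := by
  rw [restrictZero_apply, cf_const]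
  rfl

theorem restrictZero_const (f : LaurentSeries A) : restrictZero A (const f) = const f := by
  simp [restrictZero_apply, atZero, const]

theorem restrictZero_restrictZero (F : TSer A) :
    restrictZero A (restrictZero A F) = restrictZero A F := restrictZero_const _

theorem restrictZero_X (n : ℕ+) : restrictZero A (MvPowerSeries.X n) = 0 := by
  simp [restrictZero]

theorem restrictZero_mem {w : (ℕ+ →₀ ℕ) →+ ℤ} {N : ℤ} {F : TSer A} (hF : F ∈ bd A w N) :
    restrictZero A F ∈ bd A w N := fun α k hk => by
  rw [cf_restrictZero]
  split_ifs with h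
  · subst h
    exact hF 0 k hk
  · rfl

theorem restrictZero_euler (F : TSer A) : restrictZero A (euler F) = euler (restrictZero A F) :=
  ext_cf fun α k => by
    rw [cf_euler, cf_restrictZero, cf_restrictZero, cf_euler]
    split_ifs <;> simp

theorem Sums.restrictZero {w : (ℕ+ →₀ ℕ) →+ ℤ} {N : ℤ} {S : ℕ → TSer A} {s : TSer A}
    (h : Sums w N S s) :
    Sums w N (fun j => restrictZero A (S j)) (restrictZero A s) := fun J => by
  rw [← map_sum, ← map_sub]
  exact restrictZero_mem (h J)

theorem restrictZero_intPow {Φ : TSer A} (hΦ : IsUnit Φ) (k : ℤ) :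
    restrictZero A (intPow Φ k) = intPow (restrictZero A Φ) k := by
  have hinv : restrictZero A (Ring.inverse Φ) = Ring.inverse (restrictZero A Φ) := by
    have h1 : restrictZero A Φ * restrictZero A (Ring.inverse Φ) = 1 := by
      rw [← map_mul, Ring.mul_inverse_cancel _ hΦ, map_one]
    have h2 := Ring.inverse_mul_cancel_left _ (restrictZero A (Ring.inverse Φ))
      (hΦ.map (restrictZero A))
    rwa [h1, mul_one, eq_comm] at h2
  rcases k with n | n
  · exact map_pow _ _ _
  · exact (map_pow _ _ _).trans (by rw [hinv]; rfl)

variable [Algebra ℚ A] {D : Derivation ℚ A A} {w : (ℕ+ →₀ ℕ) →+ ℤ} {N : ℤ}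

theorem restrictZero_smul (q : ℚ) (F : TSer A) :
    restrictZero A (q • F) = q • restrictZero A F :=
  ext_cf fun α k => by
    rw [cf_smul, cf_restrictZero, cf_restrictZero, cf_smul]
    split_ifs <;> simp

theorem restrictZero_dx (F : TSer A) : restrictZero A (dx D F) = dx D (restrictZero A F) :=
  ext_cf fun α k => by
    rw [cf_dx, cf_restrictZero, cf_restrictZero, cf_dx]
    split_ifs <;> simp

theorem restrictZero_bracket (F G : TSer A) :
    restrictZero A (bracket D F G) = bracket D (restrictZero A F) (restrictZero A G) := by
  simp only [bracket, map_sub, map_mul, restrictZero_euler, restrictZero_dx]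

theorem restrictZero_expTerm (φ F : TSer A) (j : ℕ) :
    restrictZero A (expTerm D φ j F) = expTerm D (restrictZero A φ) j (restrictZero A F) := by
  have h : restrictZero A ((adLin D φ ^ j) F) =
      (adLin D (restrictZero A φ) ^ j) (restrictZero A F) := by
    induction j with
    | zero => simp
    | succ j ih => rw [adLin_pow_succ_apply, adLin_pow_succ_apply, restrictZero_bracket, ih]
  rw [expTerm, expTerm, LinearMap.smul_apply, LinearMap.smul_apply, restrictZero_smul, h]

theorem restrictZero_expAd {φ F : TSer A} (hφ : φ ∈ bd A w (-1)) (hF : F ∈ bd A w N) :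
    restrictZero A (expAd D φ F) = expAd D (restrictZero A φ) (restrictZero A F) := by
  refine (sums_expAd hφ hF).restrictZero.unique (?_ : Sums w N _ _)
  simp only [restrictZero_expTerm]
  exact sums_expAd (restrictZero_mem hφ) (restrictZero_mem hF)

theorem restrictZero_taylor (hw : ∀ α, 0 ≤ w α) {Y : TSer A} (hY : Y ∈ bd A w (-1)) (a : A) :
    restrictZero A (taylor D Y a) = taylor D (restrictZero A Y) a := by
  refine (sums_taylor hw hY a).restrictZero.unique (?_ : Sums w 0 _ _)
  convert sums_taylor (D := D) hw (restrictZero_mem hY) a using 1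
  funext j
  rw [taylorTerm, taylorTerm, restrictZero_smul, map_mul, map_pow, ofFun, restrictZero_const]

theorem restrictZero_timeSum {Φ : TSer A} (hΦ : Φ ∈ bd A 0 1) (ε : ℕ+ → ℤˣ) :
    restrictZero A (timeSum ε Φ) = 0 := by
  refine (sums_timeSum (ε := ε) hΦ).restrictZero.eq_zero_of_forall fun j => ?_
  rw [timeTerm_eq, restrictZero_smul, map_mul, restrictZero_X, zero_mul, smul_zero]

theorem restrictZero_bareSeries (x : A) (ε : ℕ+ → ℤˣ) :
    restrictZero A (bareSeries x ε) = ofFun x := by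
  rw [bareSeries, map_add, ← timeSum_lam, restrictZero_timeSum (lam_mem_bd_zero 1), add_zero,
    ofFun, restrictZero_const]

end RestrictionToZero

/-! ### The substitution f(Φ, Ψ). -/

section Substitution

variable [Algebra ℚ A] {D : Derivation ℚ A A} {w : (ℕ+ →₀ ℕ) →+ ℤ} {Φ Y : TSer A}
  {f : LaurentSeries A} {K : ℤ}

/-- The term of `f(Φ, x + Y)` that comes from the power `λ ^ (K - i)`. -/
def substTerm (D : Derivation ℚ A A) (f : LaurentSeries A) (K : ℤ) (Φ Y : TSer A) (i : ℕ) :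
    TSer A := taylor D Y (f.coeff (-(K - i))) * intPow Φ (K - i)

/-- The series `f(Φ, x + Y)`, where `f` does not contain powers `λ ^ k` with `k > K`. -/
def subst (D : Derivation ℚ A A) (f : LaurentSeries A) (K : ℤ) (Φ Y : TSer A) : TSer A :=
  fsum (substTerm D f K Φ Y)

theorem sums_subst (hw : ∀ α, 0 ≤ w α) (hΦ : HasPhiForm Φ) (hY : Y ∈ bd A w (-1)) :
    Sums w K (substTerm D f K Φ Y) (subst D f K Φ Y) := sums_fsum fun i =>
  bd_mono (by omega) (bd_mul (sums_taylor hw hY _).mem (bd_weight_mono hw (hΦ.intPow_mem _)))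

theorem sums_substTerm (hw : ∀ α, 0 ≤ w α) (hΦ : HasPhiForm Φ) (hY : Y ∈ bd A w (-1)) (i : ℕ) :
    Sums w (K - i) (fun j => taylorTerm D Y (f.coeff (-(K - i))) j * intPow Φ (K - i))
      (substTerm D f K Φ Y i) :=
  ((sums_taylor hw hY _).mul_right (bd_weight_mono hw (hΦ.intPow_mem _))).mono (by omega)

/-- The term from λ^m and the j-th derivative has degree at most m − j with m ≤ K, so each monomial
meets finitely many pairs and the double sum may be computed row by row. -/
theorem isSubst_subst (hw : ∀ α, 0 ≤ w α) {x : A} {Ψ : TSer A} (hΦ : HasPhiForm Φ)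
    (hY : Ψ - ofFun x ∈ bd A w (-1)) (hf : ∀ k : ℤ, K < k → f.coeff (-k) = 0) :
    IsSubst D x f Φ Ψ (subst D f K Φ (Ψ - ofFun x)) := by
  classical
  intro α k
  set S : ℤ × ℕ → TSer A := fun p => taylorTerm D (Ψ - ofFun x) (f.coeff (-p.1)) p.2 *
    intPow Φ p.1 with hS
  have hS' : ∀ p : ℤ × ℕ, scale (p.2.factorial : ℚ)⁻¹
      (ofFun (D^[p.2] (f.coeff (-p.1))) * (Ψ - ofFun x) ^ p.2 * intPow Φ p.1) = S p := by
    intro p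
    rw [scale_eq_smul, ← smul_mul_assoc]
    rfl
  simp only [hS']
  set J := (K + w α - k + 1).toNat with hJ
  let e : ℕ × ℕ → ℤ × ℕ := fun p => (K - p.1, p.2)
  have he : Function.Injective e := by
    rintro ⟨i, j⟩ ⟨i', j'⟩ h
    simp only [e, Prod.mk.injEq] at h ⊢
    omega
  have hsub : (Function.support fun p => cf (S p) α k) ⊆
      ((Finset.range J ×ˢ Finset.range J).image e : Finset (ℤ × ℕ)) := by
    rintro ⟨m, j⟩ hp
    have hm : m ≤ K := by
      by_contra hlt
      refine hp ?_
      have hD : D^[j] 0 = 0 := Function.iterate_fixed (map_zero D) j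
      have h0 : ofFun (0 : A) = 0 := by simp [ofFun, const]
      simp only [hS, hf m (by omega), taylorTerm, hD, h0, zero_mul, smul_zero, cf_zero]
    have hmj : k ≤ m - j + w α := by
      by_contra hlt
      refine hp (bd_mul (bd_taylorTerm (D := D) hw hY _ j)
        (bd_weight_mono hw (hΦ.intPow_mem m)) α k ?_)
      omega
    rw [Finset.coe_image, Set.mem_image]
    refine ⟨((K - m).toNat, j), ?_, ?_⟩
    · rw [Finset.mem_coe, Finset.mem_product, Finset.mem_range, Finset.mem_range]
      dsimp only
      omega
    · simp only [e, Prod.mk.injEq, and_true]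
      omega
  refine ⟨(Finset.finite_toSet _).subset hsub, ?_⟩
  rw [finsum_eq_sum_of_support_subset _ hsub, Finset.sum_image he.injOn, Finset.sum_product,
    (sums_subst (D := D) (f := f) (K := K) hw hΦ hY).cf_eq (J := J) (by omega)]
  refine Finset.sum_congr rfl fun i _ => ?_
  exact (sums_substTerm (D := D) hw hΦ hY i).cf_eq (by omega)

theorem derivation_subst (hw : ∀ α, 0 ≤ w α) (hΦ : HasPhiForm Φ) (hY : Y ∈ bd A w (-1))
    (δ : Derivation ℚ (TSer A) (TSer A)) {c : ℤ}
    (hδ : ∀ N F, F ∈ bd A w N → δ F ∈ bd A w (c + N)) {h : TSer A} (hh : h ∈ bd A w c)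
    (hfun : ∀ a : A, δ (ofFun a) = ofFun (D a) * h) (hδY : δ Y = -h) (hδΦ : δ Φ = 0) :
    δ (subst D f K Φ Y) = 0 := by
  have h1 : Sums w (c + K) _ _ := (sums_subst (D := D) (f := f) (K := K) hw hΦ hY).map
    (L := δ.toLinearMap.toAddMonoidHom) hδ
  refine h1.eq_zero_of_forall fun i => ?_
  change δ (substTerm D f K Φ Y i) = 0
  have h2 : δ Φ = (0 : ℚ) • Φ := by rw [hδΦ, zero_smul]
  rw [substTerm, Derivation.leibniz, derivation_taylor hw hY δ hδ hh hfun hδY,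
    derivation_intPow δ hΦ.isUnit h2, mul_zero, zero_smul, smul_zero, smul_zero, add_zero]

theorem restrictZero_subst (hw : ∀ α, 0 ≤ w α) (hΦ : HasPhiForm Φ) (hY : Y ∈ bd A w (-1)) :
    restrictZero A (subst D f K Φ Y) = subst D f K (restrictZero A Φ) (restrictZero A Y) := by
  have h1 := (sums_subst (D := D) (f := f) (K := K) hw hΦ hY).restrictZero
  have hS : (fun i => restrictZero A (substTerm D f K Φ Y i)) =
      substTerm D f K (restrictZero A Φ) (restrictZero A Y) := by
    funext i
    rw [substTerm, substTerm, map_mul, restrictZero_taylor hw hY, restrictZero_intPow hΦ.isUnit]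
  rw [hS] at h1
  -- The decay of the restricted terms is inherited from `h1`, so the form of Φ at t = 0 need not be
  -- checked.
  exact h1.unique (sums_fsum h1.term_mem)

omit [Algebra ℚ A] in
theorem sums_const (hf : ∀ k : ℤ, K < k → f.coeff (-k) = 0) :
    Sums 0 K (fun i : ℕ => ofFun (f.coeff (-(K - i))) * lam A (K - i)) (const f) := by
  intro J
  rw [mem_bd_zero]
  intro α k hk
  rw [cf_sub, cf_sum, sub_eq_zero, cf_const]
  simp only [cf_ofFun_mul, cf_lam]
  split_ifs with hα
  · by_cases hkK : K < k
    · rw [hf k hkK]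
      refine (Finset.sum_eq_zero fun i _ => ?_).symm
      rw [if_neg (by omega), mul_zero]
    · rw [Finset.sum_eq_single_of_mem (K - k).toNat (by rw [Finset.mem_range]; omega)]
      · rw [if_pos ⟨hα, by omega⟩, mul_one]
        congr 1
        omega
      · intro i _ hi
        rw [if_neg (by omega), mul_zero]
  · simp [hα]

/-- `e ^ {ad φ} f = f(e ^ {ad φ} λ, e ^ {ad φ} x)`. -/
theorem subst_expAd {x : A} {φ : TSer A} (hx : D x = 1) (hφ : φ ∈ bd A 0 (-1))
    (hf : ∀ k : ℤ, K < k → f.coeff (-k) = 0) :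
    subst D f K (expAd D φ (lam A 1)) (expAd D φ (ofFun x) - ofFun x) = expAd D φ (const f) := by
  refine (sums_subst (fun _ => le_rfl) (hasPhiForm_expAd hφ)
    (expAd_ofFun_sub_mem hφ x)).unique (?_ : Sums 0 K _ _)
  convert (sums_const hf).expAd (D := D) hφ using 1
  funext i
  rw [expAd_ofFun_mul_lam hx hφ, substTerm]

end Substitution

/-! ### Propagation of nonnegativity along the flows. -/

section NonnegativePowers

theorem cf_mul_eq_zero_of_neg {F G : TSer A} {β : ℕ+ →₀ ℕ}
    (hF : ∀ γ ≤ β, ∀ k < 0, cf F γ k = 0) (hG : ∀ γ ≤ β, ∀ k < 0, cf G γ k = 0) {k : ℤ}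
    (hk : k < 0) : cf (F * G) β k = 0 := by
  classical
  rw [cf, MvPowerSeries.coeff_mul, HahnSeries.coeff_sum]
  refine Finset.sum_eq_zero fun p hp => ?_
  rw [Finset.HasAntidiagonal.mem_antidiagonal] at hp
  rw [HahnSeries.coeff_mul]
  refine Finset.sum_eq_zero fun q hq => ?_
  rw [Finset.mem_antidiagonal] at hq
  rcases lt_or_ge (-q.1) 0 with h | h
  · have := hF p.1 (hp ▸ le_self_add) (-q.1) h
    rw [cf, neg_neg] at this
    rw [this, zero_mul]
  · have := hG p.2 (hp ▸ le_add_self) (-q.2) (by have := hq.2.2; omega)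
    rw [cf, neg_neg] at this
    rw [this, mul_zero]

variable [Algebra ℚ A] {D : Derivation ℚ A A}

/-- The flows of Hamiltonians with nonnegative powers of `λ` preserve nonnegativity. -/
theorem negPart_eq_zero_of_flow {H : ℕ+ → TSer A} (hH : ∀ n α, ∀ k < 0, cf (H n) α k = 0)
    {F : TSer A} (hF : ∀ n, dtDer A n F = bracket D (H n) F)
    (h0 : ∀ k < 0, cf F 0 k = 0) : negPart F = 0 := by
  have key : ∀ (d : ℕ) (α : ℕ+ →₀ ℕ), α.degree = d → ∀ k < 0, cf F α k = 0 := by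
    intro d
    induction d using Nat.strong_induction_on with
    | _ d ih =>
      intro α hα k hk
      rcases eq_or_ne α 0 with rfl | hne
      · exact h0 k hk
      obtain ⟨n, hn⟩ := Finsupp.ne_iff.mp hne
      obtain ⟨β, rfl⟩ : ∃ β, α = β + Finsupp.single n 1 := by
        refine ⟨α - Finsupp.single n 1, (tsub_add_cancel_of_le ?_).symm⟩
        rw [Finsupp.single_le_iff]
        exact Nat.one_le_iff_ne_zero.mpr hn
      have hβ : ∀ γ ≤ β, ∀ k < 0, cf F γ k = 0 := by
        intro γ hγ
        refine ih γ.degree ?_ γ rfl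
        have h1 : γ.degree ≤ β.degree := Finsupp.degree_mono hγ
        rw [map_add, Finsupp.degree_single] at hα
        omega
      -- The flow equation at t^β determines the coefficient at t^β t_n, up to the invertible factor
      -- β n + 1, from coefficients of F at γ ≤ β, which have smaller total degree.
      have h1 := congrArg (fun G => cf G β k) (hF n)
      have h2 : cf (bracket D (H n) F) β k = 0 := by
        rw [bracket, cf_sub, cf_mul_eq_zero_of_neg, cf_mul_eq_zero_of_neg, sub_zero] <;>
        first
        | exact hk
        | intro γ hγ k hk
          simp [cf_euler, cf_dx, hH n γ k hk, hβ γ hγ k hk]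
      simp only [h2, cf_dtDer] at h1
      exact (smul_eq_zero_iff_right (by positivity)).mp h1
  refine ext_cf fun α k => ?_
  rw [cf_negPart, cf_zero]
  split_ifs with hk
  · exact key _ α rfl k (by omega)
  · rfl

end NonnegativePowers

/-! ### The twistor structure. -/

section Twistor

variable [Algebra ℚ A] {D : Derivation ℚ A A} {ε : ℕ+ → ℤˣ} {Φ Ψ φ : TSer A} {x : A}

omit [Algebra ℚ A] in
theorem exists_coeff_eq_zero (f : LaurentSeries A) :
    ∃ K : ℤ, ∀ k : ℤ, K < k → f.coeff (-k) = 0 :=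
  ⟨-f.order, fun _ hk => HahnSeries.coeff_eq_zero_of_lt_order (by omega)⟩

theorem IsSolution.psi_sub_mem (h : IsSolution D x ε Φ Ψ) :
    Ψ - ofFun x ∈ bd A timeWeight (-1) := by
  have h1 := bd_weight_mono timeWeight_nonneg (psi_sub_timeSum_mem h.phi_form h.psi_form)
  have h2 := add_mem h1 (sums_timeSum (ε := ε) h.phi_form.mem).mem
  rwa [sub_right_comm, sub_add_cancel] at h2

/-- A function of `(Φ, Ψ)` without negative powers of `λ` at `t = 0` has none at all. -/
theorem IsSolution.negPart_subst (hx : D x = 1) (h : IsSolution D x ε Φ Ψ) {f : LaurentSeries A}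
    {K : ℤ} (h0 : ∀ k < 0, cf (restrictZero A (subst D f K Φ (Ψ - ofFun x))) 0 k = 0) :
    negPart (subst D f K Φ (Ψ - ofFun x)) = 0 := by
  refine negPart_eq_zero_of_flow (D := D) (H := hamiltonian ε Φ) (fun n α k hk => ?_)
    (fun n => ?_) fun k hk => ?_
  · rw [hamiltonian_eq, cf_smul, cf_nonnegPart, if_neg (by omega), smul_zero]
  · have hfun : ∀ a : A, laxDer D ε Φ n (ofFun a) =
        ofFun (D a) * -euler (hamiltonian ε Φ n) := by
      intro a
      rw [laxDer_apply, dtDer_ofFun, bracket_ofFun_right]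
      ring
    have hH := bd_hamiltonian (ε := ε) h.phi_form.mem n
    -- ∂/∂t n − ad(H n) kills Φ and Ψ, hence f(Φ, Ψ), which therefore obeys the same Lax equation.
    have := derivation_subst (f := f) (K := K) timeWeight_nonneg h.phi_form h.psi_sub_mem
      (laxDer D ε Φ n) (c := 2 * n) (bd_laxDer h.phi_form.mem n)
      (neg_mem (bd_euler (bd_mono (by have := n.pos; omega)
        (bd_weight_mono timeWeight_nonneg hH)))) hfun
      (by rw [map_sub, h.laxDer_psi, hfun, hx, ofFun_one, one_mul, zero_sub]) (h.laxDer_phi n)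
    rwa [laxDer_apply, sub_eq_zero] at this
  · have := h0 k hk
    rwa [cf_restrictZero, if_pos rfl] at this

theorem IsDressing.exists_twistor (hx : D x = 1) (h : IsSolution D x ε Φ Ψ)
    (hφ : IsDressing D x ε φ Φ Ψ) :
    ∃ f g : LaurentSeries A,
      IsExpAd D (-const (atZero φ)) (lam A 1) (const f) ∧
      IsExpAd D (-const (atZero φ)) (ofFun x) (const g) ∧
      IsTwistorStructure D x f g Φ Ψ := by
  have hφm : φ ∈ bd A 0 (-1) :=
    mem_bd_zero.mpr fun α k hk => hφ.neg_powers α k (by omega)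
  -- The weighted filtration is needed for `bareSeries`, whose powers of λ are not bounded uniformly
  -- in the times.
  have hφw := bd_weight_mono timeWeight_nonneg hφm
  have hφ0 : restrictZero A φ ∈ bd A 0 (-1) := restrictZero_mem hφm
  have hφ0' : -restrictZero A φ ∈ bd A 0 (-1) := neg_mem hφ0
  have hlam : restrictZero A (lam A 1) = lam A 1 := restrictZero_const _
  have hofx : restrictZero A (ofFun x) = ofFun x := restrictZero_const _
  have hΦ0 : restrictZero A Φ = expAd D (restrictZero A φ) (lam A 1) := by
    rw [hφ.phi_eq.eq_expAd hφm (lam_mem_bd_zero 1),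
      restrictZero_expAd hφm (lam_mem_bd_zero 1), hlam]
  have hΨ0 : restrictZero A (Ψ - ofFun x) = expAd D (restrictZero A φ) (ofFun x) - ofFun x := by
    rw [map_sub, hφ.psi_eq.eq_expAd hφw bareSeries_mem,
      restrictZero_expAd hφw bareSeries_mem, restrictZero_bareSeries, hofx]
  have hconst : ∀ {N : ℤ} {F : TSer A}, F ∈ bd A 0 N → restrictZero A F = F →
      const (atZero (expAd D (-restrictZero A φ) F)) = expAd D (-restrictZero A φ) F := by
    intro N F hF hF0
    rw [← restrictZero_apply, restrictZero_expAd hφ0' hF, hF0, map_neg, restrictZero_restrictZero]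
  have hsubst : ∀ {N : ℤ} {F : TSer A}, F ∈ bd A 0 N → restrictZero A F = F →
      (∀ k < 0, cf F 0 k = 0) → ∃ G,
        IsSubst D x (atZero (expAd D (-restrictZero A φ) F)) Φ Ψ G ∧ negPart G = 0 := by
    intro N F hF hF0 hFneg
    obtain ⟨K, hK⟩ := exists_coeff_eq_zero (atZero (expAd D (-restrictZero A φ) F))
    refine ⟨_, isSubst_subst timeWeight_nonneg h.phi_form h.psi_sub_mem hK,
      h.negPart_subst hx ?_⟩
    -- At t = 0 the substitution is e^{ad φ₀} applied to e^{-ad φ₀} F, which is F.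
    rwa [restrictZero_subst timeWeight_nonneg h.phi_form h.psi_sub_mem, hΦ0, hΨ0,
      subst_expAd hx hφ0 hK, hconst hF hF0, expAd_neg_cancel hφ0 hF]
  refine ⟨atZero (expAd D (-restrictZero A φ) (lam A 1)),
    atZero (expAd D (-restrictZero A φ) (ofFun x)), ?_, ?_, ?_, ?_⟩
  · rw [hconst (lam_mem_bd_zero 1) hlam]
    exact isExpAd_expAd hφ0' (lam_mem_bd_zero 1)
  · rw [hconst (ofFun_mem_bd_zero x) hofx]
    exact isExpAd_expAd hφ0' (ofFun_mem_bd_zero x)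
  · rw [hconst (lam_mem_bd_zero 1) hlam, hconst (ofFun_mem_bd_zero x) hofx,
      ← expAd_bracket hφ0' (lam_mem_bd_zero 1) (ofFun_mem_bd_zero x),
      bracket_ofFun_coordinate hx, euler_lam, Int.cast_one, one_smul]
  · obtain ⟨F, hF, hF'⟩ := hsubst (lam_mem_bd_zero 1) hlam fun k hk => by
      rw [cf_lam, if_neg (by omega)]
    obtain ⟨G, hG, hG'⟩ := hsubst (ofFun_mem_bd_zero x) hofx fun k hk => by
      rw [cf_ofFun, if_neg (by omega)]
    exact ⟨F, G, hF, hG, hF', hG'⟩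

end Twistor

end TwistorHierarchy

end

open TwistorHierarchy

theorem mainTheorem3 {A : Type*} [CommRing A] [Algebra ℚ A] (D : Derivation ℚ A A) (x : A)
    (hx : D x = 1) (ε : ℕ+ → ℤˣ) (Φ Ψ : TSer A) (hsol : IsSolution D x ε Φ Ψ) :
    (∃ φ : TSer A, IsDressing D x ε φ Φ Ψ) ∧
      ∀ φ : TSer A, IsDressing D x ε φ Φ Ψ →
        ∃ f g : LaurentSeries A,
          IsExpAd D (-const (atZero φ)) (lam A 1) (const f) ∧
          IsExpAd D (-const (atZero φ)) (ofFun x) (const g) ∧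
          IsTwistorStructure D x f g Φ Ψ :=
  ⟨hsol.exists_isDressing hx, fun _ hφ => hφ.exists_twistor hx hsol⟩
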